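/- Let $\widehat{\mathrm{G}}_0^1$ be the group, under composition, of formal diffeomorphisms of $(\mathbb{C},0)$, i.e. of formal power series $f\in\mathbb{C}[[x]]$ with $f(0)=0$ and $f'(0)\neq 0$. For a formal vector field $X=a(x)\frac{\partial}{\partial x}$ with $a\in x^2\mathbb{C}[[x]]$, let $(\exp tX)_{t\in\mathbb{C}}$ be its one-parameter group in $\widehat{\mathrm{G}}_0^1$, i.e. the unique solution $\varphi_t$ of $\frac{\partial}{\partial t}\varphi_t(x)=a(\varphi_t(x))$, $\varphi_0(x)=x$ (the derivative in $t$ being taken coefficient by coefficient). Put \[ \mathrm{A}_0=\{x\mapsto \mu x \mid \mu\in\mathbb{C}^*\}, \] and, for an integer $k\geq 1$ and $\lambda\in\mathbb{C}$, \[ X_{k,\lambda}=\frac{x^{k+1}}{1+\lambda x^k}\frac{\partial}{\partial x},\qquad \mathrm{A}_{k,\lambda}=\{\exp tX_{k,\lambda}\mid t\in\mathbb{C}\}\times\{x\mapsto \xi x\mid \xi^k=1\}\subset\widehat{\mathrm{G}}_0^1 . \] Then the maximal abelian subgroups of $\widehat{\mathrm{G}}_0^1$ are exactly the conjugates in $\widehat{\mathrm{G}}_0^1$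 of the groups $\mathrm{A}_0$ and $\mathrm{A}_{k,\lambda}$, where $k\geq 1$ is an integer and $\lambda\in\mathbb{C}$. That is, a subgroup $H$ of $\widehat{\mathrm{G}}_0^1$ is maximal (for inclusion) among the abelian subgroups if and only if there is $\varphi\in\widehat{\mathrm{G}}_0^1$ such that $H=\varphi\,\mathrm{A}_0\,\varphi^{-1}$ or $H=\varphi\,\mathrm{A}_{k,\lambda}\,\varphi^{-1}$ for some $k\geq 1$ and $\lambda\in\mathbb{C}$. -/

import Mathlib

open PowerSeries

noncomputable section

/-! ### Formal diffeomorphisms of the line fixing the origin -/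

/-- Formal diffeomorphisms of `(ℂ, 0)`: formal power series `f` with `f(0) = 0` and `f'(0) ≠ 0`. -/
@[ext]
structure FormalDiff where
  toSeries : ℂ⟦X⟧
  constantCoeff_eq : constantCoeff toSeries = 0
  coeff_one_ne : coeff 1 toSeries ≠ 0

namespace FormalDiff

theorem hasSubst (f : FormalDiff) : HasSubst f.toSeries :=
  HasSubst.of_constantCoeff_zero' f.constantCoeff_eq

theorem constantCoeff_subst_of_zero {a f : ℂ⟦X⟧} (ha : constantCoeff a = 0)
    (hf : constantCoeff f = 0) : constantCoeff (f.subst a : ℂ⟦X⟧) = 0 :=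
  constantCoeff_subst_eq_zero (τ := Unit) ha f hf

theorem coeff_one_subst {a f : ℂ⟦X⟧} (ha : constantCoeff a = 0) :
    coeff 1 (f.subst a : ℂ⟦X⟧) = coeff 1 f * coeff 1 a := by
  rw [coeff_subst' (HasSubst.of_constantCoeff_zero' ha), finsum_eq_single (a := 1)]
  · simp
  · intro n hn
    obtain ⟨b, rfl⟩ := X_dvd_iff.2 ha
    rcases n with _ | _ | n
    · simp [coeff_one]
    · exact absurd rfl hn
    · rw [mul_pow, coeff_X_pow_mul', if_neg (by omega), smul_zero]

/-- The group law is composition: `f * g = f ∘ g`, that is, `(f * g)(x) = f(g(x))`. -/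
instance : Mul FormalDiff where
  mul f g :=
    { toSeries := f.toSeries.subst g.toSeries
      constantCoeff_eq := constantCoeff_subst_of_zero g.constantCoeff_eq f.constantCoeff_eq
      coeff_one_ne := by
        rw [coeff_one_subst g.constantCoeff_eq]
        exact mul_ne_zero f.coeff_one_ne g.coeff_one_ne }

/-- The identity is the series `x`. -/
instance : One FormalDiff where
  one := { toSeries := X, constantCoeff_eq := by simp, coeff_one_ne := by simp }

instance : Inv FormalDiff where
  inv f :=
    { toSeries := f.toSeries.substInvOfIsUnit (isUnit_iff_ne_zero.2 f.coeff_one_ne)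
      constantCoeff_eq := by simp
      coeff_one_ne := by
        rw [coeff_one_substInvOfIsUnit]
        exact Units.ne_zero _ }

theorem mul_toSeries (f g : FormalDiff) :
    (f * g).toSeries = f.toSeries.subst g.toSeries := rfl

theorem one_toSeries : (1 : FormalDiff).toSeries = X := rfl

instance : Group FormalDiff :=
  Group.ofLeftAxioms
    (fun f g h => by
      ext1
      simp only [mul_toSeries]
      exact subst_comp_subst_apply g.hasSubst h.hasSubst f.toSeries)
    (fun f => by
      ext1
      rw [mul_toSeries, one_toSeries, subst_X f.hasSubst])
    (fun f => by
      ext1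
      exact subst_substInvOfIsUnit_left f.toSeries f.constantCoeff_eq
        (isUnit_iff_ne_zero.2 f.coeff_one_ne))

/-- The homothety `x ↦ κ x`, for `κ ∈ ℂˣ`. -/
def homothety : ℂˣ →* FormalDiff where
  toFun κ :=
    { toSeries := (κ : ℂ) • X
      constantCoeff_eq := by simp
      coeff_one_ne := by simp }
  map_one' := by ext1; simp [one_toSeries]
  map_mul' κ μ := by
    ext1
    simp only [mul_toSeries]
    have h : HasSubst ((μ : ℂ) • X : ℂ⟦X⟧) := HasSubst.smul_X' (μ : ℂ)
    rw [subst_smul h, subst_X h, Units.val_mul, mul_smul]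

theorem homothety_toSeries (κ : ℂˣ) : (homothety κ).toSeries = (κ : ℂ) • X := rfl

end FormalDiff

/-! ### Flows of formal vector fields -/

namespace FormalField

/-- The action `f ↦ a f'` on formal series of the formal vector field `a(x) ∂/∂x`. -/
def lieDeriv (a f : ℂ⟦X⟧) : ℂ⟦X⟧ := a * d⁄dX ℂ f

/-- The Lie series `∑ₙ (tⁿ / n!) Dⁿ f`, with `D = a(x) ∂/∂x`. It is used when `a` vanishes to order
at least `2`; then `Dⁿ f` is divisible by `xⁿ`, so only the terms with `n ≤ m` contribute to the
coefficient of `xᵐ`. -/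
def lieSeries (a : ℂ⟦X⟧) (t : ℂ) (f : ℂ⟦X⟧) : ℂ⟦X⟧ :=
  PowerSeries.mk fun m =>
    ∑ n ∈ Finset.range (m + 1), t ^ n / (n.factorial : ℂ) * coeff m ((lieDeriv a)^[n] f)

theorem X_pow_dvd_lieDeriv {a : ℂ⟦X⟧} (ha : X ^ 2 ∣ a) {n : ℕ} {f : ℂ⟦X⟧} (hf : X ^ n ∣ f) :
    X ^ (n + 1) ∣ lieDeriv a f := by
  obtain ⟨b, rfl⟩ := ha
  have h : X ∣ X * d⁄dX ℂ f ∧ X ^ n ∣ X * d⁄dX ℂ f := by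
    refine ⟨dvd_mul_right _ _, ?_⟩
    rw [X_pow_dvd_iff] at hf ⊢
    intro m hm
    cases m with
    | zero => simp
    | succ m => rw [coeff_succ_X_mul, coeff_derivative, hf _ hm, zero_mul]
  obtain ⟨c, hc⟩ := h.2
  refine ⟨b * c, ?_⟩
  calc X ^ 2 * b * d⁄dX ℂ f = X * b * (X * d⁄dX ℂ f) := by ring
    _ = X ^ (n + 1) * (b * c) := by rw [hc]; ring

theorem X_pow_dvd_iterate {a : ℂ⟦X⟧} (ha : X ^ 2 ∣ a) (f : ℂ⟦X⟧) {k : ℕ} (hf : X ^ k ∣ f)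
    (n : ℕ) : X ^ (k + n) ∣ (lieDeriv a)^[n] f := by
  induction n with
  | zero => simpa using hf
  | succ n ih =>
    rw [Function.iterate_succ_apply']
    exact X_pow_dvd_lieDeriv ha ih

theorem coeff_iterate_eq_zero {a : ℂ⟦X⟧} (ha : X ^ 2 ∣ a) (f : ℂ⟦X⟧) {m n : ℕ} (h : m < n) :
    coeff m ((lieDeriv a)^[n] f) = 0 :=
  X_pow_dvd_iff.1 (X_pow_dvd_iterate ha f (k := 0) (by simp) n) m (by omega)

theorem coeff_lieSeries {a : ℂ⟦X⟧} (ha : X ^ 2 ∣ a) (t : ℂ) (f : ℂ⟦X⟧) {m N : ℕ} (h : m < N) :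
    coeff m (lieSeries a t f) =
      ∑ n ∈ Finset.range N, t ^ n / (n.factorial : ℂ) * coeff m ((lieDeriv a)^[n] f) := by
  rw [lieSeries, coeff_mk]
  refine Finset.sum_subset (fun n hn => ?_) (fun n _ hn => ?_)
  · rw [Finset.mem_range] at *; omega
  · rw [Finset.mem_range] at hn
    rw [coeff_iterate_eq_zero ha f (by omega), mul_zero]

theorem lieDeriv_sub (a f g : ℂ⟦X⟧) : lieDeriv a (f - g) = lieDeriv a f - lieDeriv a g := by
  simp [lieDeriv, mul_sub]

/-- The coefficient of `xᵐ` in `D f` depends only on the coefficients of `f` below `m`. -/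
theorem coeff_lieDeriv_congr {a : ℂ⟦X⟧} (ha : X ^ 2 ∣ a) {f g : ℂ⟦X⟧} {m : ℕ}
    (h : ∀ i < m, coeff i f = coeff i g) : coeff m (lieDeriv a f) = coeff m (lieDeriv a g) := by
  have h1 : X ^ m ∣ f - g := X_pow_dvd_iff.2 fun i hi => by rw [map_sub, h i hi, sub_self]
  have h2 := X_pow_dvd_iff.1 (X_pow_dvd_lieDeriv ha h1) m (by omega)
  rwa [lieDeriv_sub, map_sub, sub_eq_zero] at h2

theorem lieSeries_zero (a f : ℂ⟦X⟧) : lieSeries a 0 f = f := by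
  ext m
  rw [lieSeries, coeff_mk, Finset.sum_eq_single 0]
  · simp
  · intro n _ hn
    simp [hn]
  · simp

theorem hasDerivAt_lieSeries {a : ℂ⟦X⟧} (ha : X ^ 2 ∣ a) (f : ℂ⟦X⟧) (m : ℕ) (t : ℂ) :
    HasDerivAt (fun s => coeff m (lieSeries a s f)) (coeff m (lieSeries a t (lieDeriv a f))) t := by
  have h1 : (fun s => coeff m (lieSeries a s f)) = fun s => ∑ n ∈ Finset.range (m + 2),
      s ^ n / (n.factorial : ℂ) * coeff m ((lieDeriv a)^[n] f) :=
    funext fun s => coeff_lieSeries ha s f (by omega)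
  have h2 : coeff m (lieSeries a t (lieDeriv a f)) = ∑ n ∈ Finset.range (m + 2),
      ((n : ℂ) * t ^ (n - 1) / (n.factorial : ℂ) * coeff m ((lieDeriv a)^[n] f)) := by
    rw [Finset.sum_range_succ', coeff_lieSeries ha t _ (Nat.lt_succ_self m)]
    simp only [Nat.cast_zero, zero_mul, zero_div, add_zero]
    refine Finset.sum_congr rfl fun n _ => ?_
    rw [← Function.iterate_succ_apply, Nat.add_sub_cancel, Nat.factorial_succ, Nat.cast_mul,
      mul_div_mul_left _ _ (Nat.cast_ne_zero.2 (Nat.succ_ne_zero n))]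
  rw [h1, h2]
  refine HasDerivAt.fun_sum fun n _ => ?_
  exact ((hasDerivAt_pow n t).div_const _).mul_const _

theorem lieSeries_lieDeriv {a : ℂ⟦X⟧} (ha : X ^ 2 ∣ a) (t : ℂ) (f : ℂ⟦X⟧) :
    lieSeries a t (lieDeriv a f) = lieDeriv a (lieSeries a t f) := by
  ext m
  let P : ℂ⟦X⟧ := ∑ n ∈ Finset.range (m + 1), (t ^ n / (n.factorial : ℂ)) • (lieDeriv a)^[n] f
  have hP : coeff m (lieDeriv a (lieSeries a t f)) = coeff m (lieDeriv a P) :=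
    coeff_lieDeriv_congr ha fun i hi => by
      rw [coeff_lieSeries ha t f (show i < m + 1 by omega)]
      simp [P]
  have hD : lieDeriv a P =
      ∑ n ∈ Finset.range (m + 1), (t ^ n / (n.factorial : ℂ)) • (lieDeriv a)^[n] (lieDeriv a f) := by
    simp only [P, lieDeriv, map_sum, Derivation.map_smul, Finset.mul_sum, mul_smul_comm]
    refine Finset.sum_congr rfl fun n _ => ?_
    congr 1
    exact (Function.iterate_succ_apply' (lieDeriv a) n f).symm
  rw [hP, hD, coeff_lieSeries ha t _ (Nat.lt_succ_self m)]
  simp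

/-- Uniqueness for the linear equation `∂F/∂t = D F` on formal series. -/
theorem linear_unique {a : ℂ⟦X⟧} (ha : X ^ 2 ∣ a) {F G : ℂ → ℂ⟦X⟧}
    (hF : ∀ m t, HasDerivAt (fun s => coeff m (F s)) (coeff m (lieDeriv a (F t))) t)
    (hG : ∀ m t, HasDerivAt (fun s => coeff m (G s)) (coeff m (lieDeriv a (G t))) t)
    (h0 : F 0 = G 0) (t : ℂ) : F t = G t := by
  suffices h : ∀ m t, coeff m (F t) = coeff m (G t) from PowerSeries.ext fun m => h m t
  intro m
  induction m using Nat.strong_induction_on with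
  | _ m ih =>
    intro t
    have hd : ∀ s, HasDerivAt (fun s => coeff m (F s) - coeff m (G s)) 0 s := fun s => by
      have h := (hF m s).sub (hG m s)
      rwa [coeff_lieDeriv_congr ha fun i hi => ih i hi s, sub_self] at h
    have hc := is_const_of_deriv_eq_zero (fun s => (hd s).differentiableAt)
      (fun s => (hd s).deriv) t 0
    simp only [h0, sub_self] at hc
    exact sub_eq_zero.1 hc

theorem hasDerivAt_lieSeries' {a : ℂ⟦X⟧} (ha : X ^ 2 ∣ a) (f : ℂ⟦X⟧) (m : ℕ) (t : ℂ) :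
    HasDerivAt (fun s => coeff m (lieSeries a s f)) (coeff m (lieDeriv a (lieSeries a t f))) t := by
  rw [← lieSeries_lieDeriv ha]
  exact hasDerivAt_lieSeries ha f m t

theorem lieSeries_add {a : ℂ⟦X⟧} (t : ℂ) (f g : ℂ⟦X⟧) :
    lieSeries a t (f + g) = lieSeries a t f + lieSeries a t g := by
  have h : ∀ n, (lieDeriv a)^[n] (f + g) = (lieDeriv a)^[n] f + (lieDeriv a)^[n] g := by
    intro n
    induction n with
    | zero => rfl
    | succ n ih => simp only [Function.iterate_succ_apply', ih, lieDeriv, map_add, mul_add]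
  ext m
  simp [lieSeries, h, mul_add, Finset.sum_add_distrib]

theorem lieSeries_C {a : ℂ⟦X⟧} (t c : ℂ) : lieSeries a t (C c) = C c := by
  have h : ∀ n, (lieDeriv a)^[n + 1] (C c) = 0 := by
    intro n
    induction n with
    | zero => simp [lieDeriv]
    | succ n ih => rw [Function.iterate_succ_apply', ih]; simp [lieDeriv]
  ext m
  rw [lieSeries, coeff_mk, Finset.sum_range_succ']
  simp [h]

theorem lieSeries_mul {a : ℂ⟦X⟧} (ha : X ^ 2 ∣ a) (t : ℂ) (f g : ℂ⟦X⟧) :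
    lieSeries a t (f * g) = lieSeries a t f * lieSeries a t g := by
  refine linear_unique ha (F := fun t => lieSeries a t (f * g))
    (G := fun t => lieSeries a t f * lieSeries a t g)
    (hasDerivAt_lieSeries' ha (f * g)) (fun m t => ?_) (by simp [lieSeries_zero]) t
  have h : lieDeriv a (lieSeries a t f * lieSeries a t g) =
      lieDeriv a (lieSeries a t f) * lieSeries a t g +
        lieSeries a t f * lieDeriv a (lieSeries a t g) := by
    simp only [lieDeriv, Derivation.leibniz, smul_eq_mul]
    ring
  simp only [h, map_add, coeff_mul, ← Finset.sum_add_distrib]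
  exact HasDerivAt.fun_sum fun p _ =>
    (hasDerivAt_lieSeries' ha f p.1 t).mul (hasDerivAt_lieSeries' ha g p.2 t)

theorem X_pow_dvd_lieSeries {a : ℂ⟦X⟧} (ha : X ^ 2 ∣ a) (t : ℂ) {f : ℂ⟦X⟧} {k : ℕ}
    (hf : X ^ k ∣ f) : X ^ k ∣ lieSeries a t f := by
  rw [X_pow_dvd_iff]
  intro m hm
  rw [lieSeries, coeff_mk]
  refine Finset.sum_eq_zero fun n _ => ?_
  rw [X_pow_dvd_iff.1 (X_pow_dvd_iterate ha f hf n) m (by omega), mul_zero]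

theorem constantCoeff_lieSeries_X {a : ℂ⟦X⟧} (ha : X ^ 2 ∣ a) (t : ℂ) :
    constantCoeff (lieSeries a t X) = 0 := by
  have h := X_pow_dvd_lieSeries ha t (f := X) (k := 1) (by simp)
  rwa [pow_one, X_dvd_iff] at h

theorem coeff_one_lieSeries_X {a : ℂ⟦X⟧} (ha : X ^ 2 ∣ a) (t : ℂ) :
    coeff 1 (lieSeries a t X) = 1 := by
  rw [lieSeries, coeff_mk, Finset.sum_range_succ, Finset.sum_range_one,
    X_pow_dvd_iff.1 (X_pow_dvd_iterate ha X (k := 1) (by simp) 1) 1 (by omega)]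
  simp

/-- The Lie series is substitution of the Lie series of `x`. -/
theorem lieSeries_eq_subst {a : ℂ⟦X⟧} (ha : X ^ 2 ∣ a) (t : ℂ) (f : ℂ⟦X⟧) :
    lieSeries a t f = f.subst (lieSeries a t X) := by
  have hs : HasSubst (lieSeries a t X) :=
    HasSubst.of_constantCoeff_zero' (constantCoeff_lieSeries_X ha t)
  let E : ℂ⟦X⟧ →ₐ[ℂ] ℂ⟦X⟧ :=
    { toFun := lieSeries a t
      map_one' := by simpa using lieSeries_C (a := a) t 1
      map_mul' := lieSeries_mul ha t
      map_zero' := by simpa using lieSeries_C (a := a) t 0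
      map_add' := lieSeries_add t
      commutes' := fun c => lieSeries_C t c }
  have hpol : ∀ p : Polynomial ℂ, lieSeries a t (p : ℂ⟦X⟧) = (p : ℂ⟦X⟧).subst (lieSeries a t X) := by
    intro p
    rw [subst_coe hs]
    change E (p : ℂ⟦X⟧) = Polynomial.aeval (E X) p
    rw [Polynomial.aeval_algHom_apply]
    congr 1
    have h := subst_coe (R := ℂ) (HasSubst.X' (R := ℂ)) p
    rw [← h]
    exact (X_subst (p : ℂ⟦X⟧)).symm
  ext m
  obtain ⟨g, hg⟩ : X ^ (m + 1) ∣ f - (trunc (m + 1) f : ℂ⟦X⟧) := by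
    rw [X_pow_dvd_iff]
    intro i hi
    rw [map_sub, Polynomial.coeff_coe, coeff_trunc, if_pos hi, sub_self]
  obtain ⟨u, hu⟩ := X_dvd_iff.2 (constantCoeff_lieSeries_X ha t)
  rw [sub_eq_iff_eq_add.1 hg, lieSeries_add, subst_add hs, map_add, map_add, hpol]
  congr 1
  rw [X_pow_dvd_iff.1 (X_pow_dvd_lieSeries ha t (dvd_mul_right _ g)) m (by omega), subst_mul hs,
    subst_pow hs, subst_X hs, hu, mul_pow, mul_assoc]
  exact (X_pow_dvd_iff.1 (dvd_mul_right _ _) m (by omega)).symm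

theorem lieSeries_add_time {a : ℂ⟦X⟧} (ha : X ^ 2 ∣ a) (s t : ℂ) (f : ℂ⟦X⟧) :
    lieSeries a (s + t) f = lieSeries a t (lieSeries a s f) := by
  refine linear_unique ha (F := fun t => lieSeries a (s + t) f)
    (G := fun t => lieSeries a t (lieSeries a s f)) (fun m t => ?_)
    (hasDerivAt_lieSeries' ha _) (by simp [lieSeries_zero]) t
  exact (hasDerivAt_lieSeries' ha f m (s + t)).comp_const_add s t

/-- The one-parameter group `t ↦ exp t (a(x) ∂/∂x)` of a formal vector field vanishing to order at
least `2` at the origin. By `isSolution_flow` and `IsSolution.eq_flow` below it is the unique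
solution `φ` of `∂φ_t(x)/∂t = a(φ_t(x))`, `φ_0(x) = x`. -/
def flow (a : ℂ⟦X⟧) (ha : X ^ 2 ∣ a) : Multiplicative ℂ →* FormalDiff where
  toFun t :=
    { toSeries := lieSeries a t.toAdd X
      constantCoeff_eq := constantCoeff_lieSeries_X ha _
      coeff_one_ne := by rw [coeff_one_lieSeries_X ha]; exact one_ne_zero }
  map_one' := by ext1; exact lieSeries_zero a X
  map_mul' s t := by
    ext1
    rw [FormalDiff.mul_toSeries, ← lieSeries_eq_subst ha]
    exact lieSeries_add_time ha _ _ X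

theorem flow_toSeries (a : ℂ⟦X⟧) (ha : X ^ 2 ∣ a) (t : Multiplicative ℂ) :
    (flow a ha t).toSeries = lieSeries a t.toAdd X := rfl

/-- `φ` solves `∂φ_t(x)/∂t = a(φ_t(x))`, `φ_0(x) = x`, coefficient by coefficient in `x`. -/
def IsSolution (a : ℂ⟦X⟧) (φ : ℂ → FormalDiff) : Prop :=
  φ 0 = 1 ∧ ∀ (m : ℕ) (t : ℂ), HasDerivAt (fun s => coeff m (φ s).toSeries)
    (coeff m (a.subst (φ t).toSeries : ℂ⟦X⟧)) t

theorem isSolution_flow (a : ℂ⟦X⟧) (ha : X ^ 2 ∣ a) :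
    IsSolution a fun t => flow a ha (Multiplicative.ofAdd t) := by
  refine ⟨(flow a ha).map_one, fun m t => ?_⟩
  have h := hasDerivAt_lieSeries ha X m t
  have hX : lieDeriv a X = a := by simp [lieDeriv]
  rw [hX, lieSeries_eq_subst ha t a] at h
  exact h

theorem coeff_subst_congr {a : ℂ⟦X⟧} (ha : X ^ 2 ∣ a) (f g : FormalDiff) {m : ℕ}
    (h : ∀ i < m, coeff i f.toSeries = coeff i g.toSeries) :
    coeff m (a.subst f.toSeries : ℂ⟦X⟧) = coeff m (a.subst g.toSeries : ℂ⟦X⟧) := by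
  rw [coeff_subst' f.hasSubst, coeff_subst' g.hasSubst]
  refine finsum_congr fun d => ?_
  rcases Nat.lt_or_ge d 2 with hd | hd
  · rw [X_pow_dvd_iff.1 ha d hd, zero_smul, zero_smul]
  · congr 1
    obtain ⟨q, hq⟩ : X ^ m ∣ f.toSeries - g.toSeries :=
      X_pow_dvd_iff.2 fun i hi => by rw [map_sub, h i hi, sub_self]
    obtain ⟨u, hu⟩ := X_dvd_iff.2 f.constantCoeff_eq
    obtain ⟨v, hv⟩ := X_dvd_iff.2 g.constantCoeff_eq
    have key : X ^ (m + 1) ∣ f.toSeries ^ d - g.toSeries ^ d := by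
      rw [← Commute.geom_sum₂_mul (Commute.all _ _) d, hq]
      have hX : X ∣ ∑ i ∈ Finset.range d, f.toSeries ^ i * g.toSeries ^ (d - 1 - i) := by
        refine Finset.dvd_sum fun i _ => ?_
        rcases Nat.eq_zero_or_pos i with hi | hi
        · refine Dvd.dvd.mul_left (dvd_pow ⟨v, hv⟩ (by omega)) _
        · exact Dvd.dvd.mul_right (dvd_pow ⟨u, hu⟩ (by omega)) _
      obtain ⟨w, hw⟩ := hX
      rw [hw]
      exact ⟨w * q, by ring⟩
    have := X_pow_dvd_iff.1 key m (by omega)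
    rwa [map_sub, sub_eq_zero] at this

theorem IsSolution.eq_flow {a : ℂ⟦X⟧} (ha : X ^ 2 ∣ a) {φ : ℂ → FormalDiff}
    (hφ : IsSolution a φ) (t : ℂ) : φ t = flow a ha (Multiplicative.ofAdd t) := by
  have hψ := isSolution_flow a ha
  suffices h : ∀ m t, coeff m (φ t).toSeries =
      coeff m (flow a ha (Multiplicative.ofAdd t)).toSeries from
    FormalDiff.ext (PowerSeries.ext fun m => h m t)
  intro m
  induction m using Nat.strong_induction_on with
  | _ m ih =>
    intro t
    have hd : ∀ s, HasDerivAt (fun s => coeff m (φ s).toSeries -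
        coeff m (flow a ha (Multiplicative.ofAdd s)).toSeries) 0 s := fun s => by
      have h := (hφ.2 m s).sub (hψ.2 m s)
      rwa [coeff_subst_congr ha _ _ fun i hi => ih i hi s, sub_self] at h
    have hc := is_const_of_deriv_eq_zero (fun s => (hd s).differentiableAt)
      (fun s => (hd s).deriv) t 0
    have h0 : φ 0 = flow a ha (Multiplicative.ofAdd 0) := hφ.1.trans hψ.1.symm
    simp only [h0, sub_self] at hc
    exact sub_eq_zero.1 hc

/-! ### The model fields `x^(k+1) / (1 + lam x^k) ∂/∂x` -/

/-- The coefficient `x^(k+1) / (1 + lam x^k)` of the field `X_{k,lam}`. -/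
def modelField (k : ℕ) (lam : ℂ) : ℂ⟦X⟧ := X ^ (k + 1) * (1 + C lam * X ^ k)⁻¹

theorem X_sq_dvd_modelField {k : ℕ} (hk : 1 ≤ k) (lam : ℂ) : X ^ 2 ∣ modelField k lam :=
  Dvd.dvd.mul_right (pow_dvd_pow X (by omega)) _

/-- The formal expression of `modelField` is a genuine quotient. -/
theorem modelField_mul {k : ℕ} (hk : 1 ≤ k) (lam : ℂ) :
    modelField k lam * (1 + C lam * X ^ k) = X ^ (k + 1) := by
  rw [modelField, mul_assoc, PowerSeries.inv_mul_cancel, mul_one]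
  simp [show k ≠ 0 by omega]

theorem derivative_subst_smul (ξ : ℂ) (f : ℂ⟦X⟧) :
    d⁄dX ℂ (f.subst (ξ • X : ℂ⟦X⟧) : ℂ⟦X⟧) = ξ • (d⁄dX ℂ f).subst (ξ • X : ℂ⟦X⟧) := by
  rw [derivative_subst (HasSubst.smul_X' ξ), Derivation.map_smul, derivative_X, mul_smul_comm,
    mul_one]

theorem modelField_subst {k : ℕ} (hk : 1 ≤ k) (lam : ℂ) {ξ : ℂ} (hξ : ξ ^ k = 1) :
    (modelField k lam).subst (ξ • X : ℂ⟦X⟧) = ξ • modelField k lam := by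
  have hs : HasSubst (ξ • X : ℂ⟦X⟧) := HasSubst.smul_X' ξ
  have hu : (1 + C lam * X ^ k : ℂ⟦X⟧) ≠ 0 := by
    intro h
    have := congrArg constantCoeff h
    simp [show k ≠ 0 by omega] at this
  have hpow : ((ξ • X : ℂ⟦X⟧)) ^ k = X ^ k := by rw [smul_pow, hξ, one_smul]
  have hsu : (1 + C lam * X ^ k : ℂ⟦X⟧).subst (ξ • X : ℂ⟦X⟧) = 1 + C lam * X ^ k := by
    rw [← coe_substAlgHom hs, map_add, map_one, map_mul, map_pow, coe_substAlgHom hs, subst_X hs,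
      hpow]
    congr 2
    exact subst_C lam
  have h := congrArg (subst (ξ • X : ℂ⟦X⟧)) (modelField_mul hk lam)
  rw [subst_mul hs, hsu, subst_pow hs, subst_X hs, pow_succ, hpow, mul_smul_comm, ← pow_succ,
    ← modelField_mul hk lam, ← smul_mul_assoc] at h
  exact mul_right_cancel₀ hu h

theorem lieSeries_smul (a : ℂ⟦X⟧) (t c : ℂ) (f : ℂ⟦X⟧) :
    lieSeries a t (c • f) = c • lieSeries a t f := by
  have h : ∀ n, (lieDeriv a)^[n] (c • f) = c • (lieDeriv a)^[n] f := by
    intro n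
    induction n with
    | zero => rfl
    | succ n ih => simp only [Function.iterate_succ_apply', ih, lieDeriv, Derivation.map_smul,
        mul_smul_comm]
  ext m
  simp [lieSeries, h, Finset.mul_sum, mul_left_comm]

/-- The flow of `X_{k,lam}` commutes with the homotheties of ratio a `k`-th root of unity. -/
theorem commute_flow_homothety {k : ℕ} (hk : 1 ≤ k) (lam : ℂ) (t : Multiplicative ℂ) (ξ : ℂˣ)
    (hξ : ξ ^ k = 1) :
    Commute (flow (modelField k lam) (X_sq_dvd_modelField hk lam) t)
      (FormalDiff.homothety ξ) := by
  have hξ' : (ξ : ℂ) ^ k = 1 := by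
    rw [← Units.val_pow_eq_pow_val, hξ, Units.val_one]
  have hs : HasSubst ((ξ : ℂ) • X : ℂ⟦X⟧) := HasSubst.smul_X' (ξ : ℂ)
  have ha := X_sq_dvd_modelField hk lam
  have hD : ∀ f : ℂ⟦X⟧, (lieDeriv (modelField k lam) f).subst ((ξ : ℂ) • X : ℂ⟦X⟧) =
      lieDeriv (modelField k lam) (f.subst ((ξ : ℂ) • X : ℂ⟦X⟧)) := by
    intro f
    rw [lieDeriv, lieDeriv, subst_mul hs, modelField_subst hk lam hξ', derivative_subst_smul,
      mul_smul_comm, smul_mul_assoc]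
  have hI : ∀ (n : ℕ) (f : ℂ⟦X⟧),
      ((lieDeriv (modelField k lam))^[n] f).subst ((ξ : ℂ) • X : ℂ⟦X⟧) =
      (lieDeriv (modelField k lam))^[n] (f.subst ((ξ : ℂ) • X : ℂ⟦X⟧)) := by
    intro n
    induction n with
    | zero => intro f; rfl
    | succ n ih => intro f; rw [Function.iterate_succ_apply, Function.iterate_succ_apply, ih, hD]
  have hco : ∀ (m : ℕ) (f : ℂ⟦X⟧),
      coeff m (f.subst ((ξ : ℂ) • X : ℂ⟦X⟧) : ℂ⟦X⟧) = (ξ : ℂ) ^ m * coeff m f := by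
    intro m f
    rw [← rescale_eq_subst, coeff_rescale]
  rw [commute_iff_eq]
  ext1
  rw [FormalDiff.mul_toSeries, FormalDiff.mul_toSeries, flow_toSeries,
    FormalDiff.homothety_toSeries]
  have hs2 : HasSubst (lieSeries (modelField k lam) t.toAdd X) :=
    HasSubst.of_constantCoeff_zero' (constantCoeff_lieSeries_X ha _)
  rw [subst_smul hs2, subst_X hs2, ← lieSeries_smul]
  ext m
  rw [hco, lieSeries, lieSeries, coeff_mk, coeff_mk, Finset.mul_sum]
  refine Finset.sum_congr rfl fun n _ => ?_
  rw [mul_left_comm, ← hco, hI, subst_X hs]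

end FormalField

/-! ### The model abelian subgroups -/

namespace FormalDiff

/-- The group `A₀` of all homotheties `x ↦ μ x`, `μ ∈ ℂˣ`. -/
def subgroupA0 : Subgroup FormalDiff := homothety.range

/-- The group `A_{k,lam} = {exp t X_{k,lam} | t ∈ ℂ} × {x ↦ ξ x | ξ ^ k = 1}`: the image of
`(t, ξ) ↦ exp t X_{k,lam} ∘ (x ↦ ξ x)`. -/
def subgroupA (k : ℕ) (hk : 1 ≤ k) (lam : ℂ) : Subgroup FormalDiff :=
  (MonoidHom.noncommCoprod
    (FormalField.flow (FormalField.modelField k lam) (FormalField.X_sq_dvd_modelField hk lam))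
    (homothety.comp (rootsOfUnity k ℂ).subtype)
    (fun t ξ => FormalField.commute_flow_homothety hk lam t ξ ξ.2)).range

end FormalDiff

end

namespace FormalDiff

/-! ### Estimates for substitution -/

/-! Let `H` be maximal abelian. Everything depends on whether the multiplier `f ↦ f'(0)` is
injective on `H`.

If it is, `H` is linearised simultaneously by some `φ` (`exists_linearization`). When the
multipliers have no common finite order, the equations `φ ∘ h = h'(0) φ` are solved degree by
degree. Otherwise injectivity embeds `H` in a group of roots of unity, so `H` is finite and
averaging applies. Thus `H` lies in a conjugate of `A₀`, and maximality gives equality.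

If it is not, `H` contains some `f = x + a x^(k+1) + ⋯` with `k ≥ 1` and `a ≠ 0`. Such an `f` is
conjugate to some `exp X_{k,lam}` (`exists_conjugacy_modelField`): every term of the defect can be
removed by a change of coordinate except the one in degree `2k+1`, which the choice of `lam`
absorbs. The centralizer of `exp X_{k,lam}` lies in `A_{k,lam}` (`mem_subgroupA_of_commute`),
because commuting nontrivial maps tangent to the identity have the same order of contact with it. So
`H` lies in a conjugate of `A_{k,lam}`, and again equality holds.

Conversely, each model group is abelian and contains an element (`x ↦ 2x`, or `exp X_{k,lam}`) whose
centralizer is no larger than the group, so no abelian subgroup is strictly larger. -/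

theorem X_pow_dvd_subst {h u : ℂ⟦X⟧} (hh : constantCoeff h = 0) {n : ℕ} (hu : X ^ n ∣ u) :
    X ^ n ∣ (u.subst h : ℂ⟦X⟧) := by
  have hs : HasSubst h := HasSubst.of_constantCoeff_zero' hh
  obtain ⟨w, rfl⟩ := hu
  rw [subst_mul hs, subst_pow hs, subst_X hs]
  exact (pow_dvd_pow_of_dvd (X_dvd_iff.2 hh) n).mul_right _

theorem constantCoeff_subst_eq {h : ℂ⟦X⟧} (hh : constantCoeff h = 0) (w : ℂ⟦X⟧) :
    constantCoeff (w.subst h : ℂ⟦X⟧) = constantCoeff w := by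
  have hs : HasSubst h := HasSubst.of_constantCoeff_zero' hh
  obtain ⟨v, hv⟩ : X ∣ w - C (constantCoeff w) := X_dvd_iff.2 (by simp)
  have hC : (C (constantCoeff w) : ℂ⟦X⟧).subst h = (C (constantCoeff w) : ℂ⟦X⟧) :=
    subst_C _
  rw [sub_eq_iff_eq_add.1 hv, subst_add hs, subst_mul hs, subst_X hs, hC]
  simp [hh]

theorem coeff_subst_of_X_pow_dvd {h u : ℂ⟦X⟧} (hh : constantCoeff h = 0) {n : ℕ}
    (hu : X ^ n ∣ u) : coeff n (u.subst h : ℂ⟦X⟧) = coeff n u * coeff 1 h ^ n := by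
  have hs : HasSubst h := HasSubst.of_constantCoeff_zero' hh
  obtain ⟨w, rfl⟩ := hu
  obtain ⟨v, rfl⟩ := X_dvd_iff.2 hh
  rw [subst_mul hs, subst_pow hs, subst_X hs, mul_pow, mul_assoc, coeff_X_pow_mul', if_pos le_rfl,
    coeff_X_pow_mul', if_pos le_rfl, Nat.sub_self]
  have h1 : coeff 1 (X * v) = constantCoeff v := by
    rw [coeff_succ_X_mul 0 v, coeff_zero_eq_constantCoeff_apply]
  simp only [coeff_zero_eq_constantCoeff_apply, map_mul, map_pow, h1, constantCoeff_subst_eq hh]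
  ring

/-- Truncate `w` at degree `N`: the tail stays divisible by `X ^ N` after either substitution, and
for a polynomial `p`, `h - g` divides `p(h) - p(g)`. -/
theorem X_pow_dvd_subst_sub_subst {g h : ℂ⟦X⟧} (hg : constantCoeff g = 0)
    (hh : constantCoeff h = 0) {N : ℕ} (hN : X ^ N ∣ h - g) (w : ℂ⟦X⟧) :
    X ^ N ∣ (w.subst h - w.subst g : ℂ⟦X⟧) := by
  have hsg : HasSubst g := HasSubst.of_constantCoeff_zero' hg
  have hsh : HasSubst h := HasSubst.of_constantCoeff_zero' hh
  have hr : X ^ N ∣ w - (trunc N w : ℂ⟦X⟧) := by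
    rw [X_pow_dvd_iff]
    intro i hi
    rw [map_sub, Polynomial.coeff_coe, coeff_trunc, if_pos hi, sub_self]
  have hp : X ^ N ∣ ((trunc N w : ℂ⟦X⟧).subst h - (trunc N w : ℂ⟦X⟧).subst g : ℂ⟦X⟧) := by
    rw [subst_coe hsh, subst_coe hsg, Polynomial.aeval_def, Polynomial.aeval_def,
      ← Polynomial.eval_map, ← Polynomial.eval_map]
    exact hN.trans (Polynomial.sub_dvd_eval_sub _ _ _)
  have e : (w.subst h - w.subst g : ℂ⟦X⟧) =
      (w - (trunc N w : ℂ⟦X⟧)).subst h - (w - (trunc N w : ℂ⟦X⟧)).subst g +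
      ((trunc N w : ℂ⟦X⟧).subst h - (trunc N w : ℂ⟦X⟧).subst g) := by
    rw [subst_sub hsh, subst_sub hsg]
    ring
  rw [e]
  exact ((X_pow_dvd_subst hh hr).sub (X_pow_dvd_subst hg hr)).add hp

/-- With `g = X g'` and `h = X (g' + X^l v)`, the geometric sum factors the difference of powers. As
`l ≥ 1`, its `p + 1` summands all have constant term `g'(0)^p`. -/
theorem exists_pow_sub_pow_eq {g h : ℂ⟦X⟧} (hg : constantCoeff g = 0) {l : ℕ} (hl : 1 ≤ l)
    (hd : X ^ (l + 1) ∣ h - g) (p : ℕ) :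
    ∃ q : ℂ⟦X⟧, h ^ (p + 1) - g ^ (p + 1) = X ^ (p + 1 + l) * q ∧
      constantCoeff q = (p + 1 : ℂ) * coeff 1 g ^ p * coeff (l + 1) (h - g) := by
  obtain ⟨v, hv⟩ := hd
  obtain ⟨g', rfl⟩ := X_dvd_iff.2 hg
  have hh : h = X * (g' + X ^ l * v) := by
    rw [sub_eq_iff_eq_add.1 hv]
    ring
  have h1 : coeff 1 (X * g') = constantCoeff g' := by
    rw [coeff_succ_X_mul 0 g', coeff_zero_eq_constantCoeff_apply]
  refine ⟨(∑ i ∈ Finset.range (p + 1), (g' + X ^ l * v) ^ i * g' ^ (p + 1 - 1 - i)) * v, ?_, ?_⟩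
  · have h2 := (Commute.all (g' + X ^ l * v) g').geom_sum₂_mul (p + 1)
    have h3 : (g' + X ^ l * v) - g' = X ^ l * v := by ring
    rw [h3] at h2
    rw [hh, mul_pow, mul_pow, ← mul_sub, ← h2]
    ring
  · rw [hv, coeff_X_pow_mul', if_pos le_rfl, Nat.sub_self, h1, map_mul, map_sum,
      coeff_zero_eq_constantCoeff_apply]
    congr 1
    rw [Finset.sum_congr rfl (g := fun _ => constantCoeff g' ^ p)]
    · simp
    · intro i hi
      rw [Finset.mem_range] at hi
      simp only [map_mul, map_pow, map_add, constantCoeff_X, zero_pow (show l ≠ 0 by omega),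
        zero_mul, add_zero, ← pow_add]
      congr 1
      omega

theorem X_pow_dvd_subst_sub_subst_of_dvd {g h u : ℂ⟦X⟧} (hg : constantCoeff g = 0)
    (hh : constantCoeff h = 0) {l p : ℕ} (hl : 1 ≤ l) (hd : X ^ (l + 1) ∣ h - g)
    (hu : X ^ p ∣ u) : X ^ (p + l) ∣ (u.subst h - u.subst g : ℂ⟦X⟧) := by
  have hsg : HasSubst g := HasSubst.of_constantCoeff_zero' hg
  have hsh : HasSubst h := HasSubst.of_constantCoeff_zero' hh
  cases p with
  | zero =>
    exact (pow_dvd_pow X (by omega)).trans (X_pow_dvd_subst_sub_subst hg hh hd u)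
  | succ p =>
    obtain ⟨w, rfl⟩ := hu
    obtain ⟨q, hq, -⟩ := exists_pow_sub_pow_eq hg hl hd p
    obtain ⟨r, hr⟩ := X_pow_dvd_subst_sub_subst hg hh hd w
    obtain ⟨s, rfl⟩ := X_dvd_iff.2 hg
    rw [subst_mul hsh, subst_mul hsg, subst_pow hsh, subst_pow hsg, subst_X hsh, subst_X hsg]
    refine ⟨q * w.subst h + X * s ^ (p + 1) * r, ?_⟩
    rw [sub_eq_iff_eq_add.1 hq, sub_eq_iff_eq_add.1 hr]
    ring

/-- First-order Taylor expansion: the leading term of `u(h) - u(g)` is that of `u'(g) (h - g)`. This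
computes all the leading coefficients used below. -/
theorem coeff_subst_sub_subst {g h u : ℂ⟦X⟧} (hg : constantCoeff g = 0)
    (hh : constantCoeff h = 0) {l p : ℕ} (hl : 1 ≤ l) (hd : X ^ (l + 1) ∣ h - g)
    (hu : X ^ (p + 1) ∣ u) :
    coeff (p + 1 + l) (u.subst h - u.subst g : ℂ⟦X⟧) =
      (p + 1 : ℂ) * coeff (p + 1) u * coeff 1 g ^ p * coeff (l + 1) (h - g) := by
  have hsg : HasSubst g := HasSubst.of_constantCoeff_zero' hg
  have hsh : HasSubst h := HasSubst.of_constantCoeff_zero' hh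
  obtain ⟨w, rfl⟩ := hu
  obtain ⟨w', hw⟩ : X ∣ w - C (constantCoeff w) := X_dvd_iff.2 (by simp)
  obtain ⟨q, hq, hq0⟩ := exists_pow_sub_pow_eq hg hl hd p
  have hrem := X_pow_dvd_subst_sub_subst_of_dvd hg hh hl hd
    (dvd_mul_right (X ^ (p + 2)) w')
  have e : X ^ (p + 1) * w = constantCoeff w • X ^ (p + 1) + X ^ (p + 2) * w' := by
    rw [sub_eq_iff_eq_add.1 hw, smul_eq_C_mul]
    simp
    ring
  have e2 : ((X ^ (p + 1) * w).subst h - (X ^ (p + 1) * w).subst g : ℂ⟦X⟧) =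
      constantCoeff w • (X ^ (p + 1 + l) * q) +
        ((X ^ (p + 2) * w').subst h - (X ^ (p + 2) * w').subst g) := by
    rw [e, subst_add hsh, subst_add hsg, subst_smul hsh, subst_smul hsg, subst_pow hsh,
      subst_pow hsg, subst_X hsh, subst_X hsg, ← hq, smul_sub]
    ring
  rw [e2, map_add, X_pow_dvd_iff.1 hrem (p + 1 + l) (by omega), add_zero, coeff_smul,
    coeff_X_pow_mul', if_pos le_rfl, Nat.sub_self, coeff_zero_eq_constantCoeff_apply, hq0,
    coeff_X_pow_mul', if_pos le_rfl, Nat.sub_self, coeff_zero_eq_constantCoeff_apply, smul_eq_mul]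
  ring

/-- Successive approximation in the `X`-adic topology. -/
theorem exists_X_adic_limit (P : ℕ → ℂ⟦X⟧ → Prop) {f₀ : ℂ⟦X⟧} (h₀ : P 0 f₀)
    (step : ∀ n f, P n f → ∃ g, P (n + 1) g ∧ X ^ n ∣ g - f) :
    ∃ f : ℂ⟦X⟧, ∀ n, ∃ g, P n g ∧ X ^ n ∣ f - g := by
  choose! T hT hTd using step
  let s : ℕ → ℂ⟦X⟧ := fun n => Nat.rec f₀ (fun n f => T n f) n
  have hs : ∀ n, P n (s n) := fun n => by
    induction n with
    | zero => exact h₀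
    | succ n ih => exact hT n _ ih
  have hstep : ∀ n, X ^ n ∣ s (n + 1) - s n := fun n => hTd n _ (hs n)
  have hcoeff : ∀ m n, m < n → coeff m (s n) = coeff m (s (m + 1)) := by
    intro m n hmn
    induction n, (show m + 1 ≤ n from hmn) using Nat.le_induction with
    | base => rfl
    | succ n hn ih =>
      have := X_pow_dvd_iff.1 (hstep n) m hn
      rw [map_sub, sub_eq_zero] at this
      rw [this, ih hn]
  -- The coefficient of degree `m` is frozen from stage `m + 1` on.
  refine ⟨PowerSeries.mk fun m => coeff m (s (m + 1)), fun n => ⟨s n, hs n, ?_⟩⟩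
  rw [X_pow_dvd_iff]
  intro m hm
  rw [map_sub, coeff_mk, hcoeff m n hm, sub_self]

theorem eq_zero_of_forall_X_pow_dvd {f : ℂ⟦X⟧} (h : ∀ n, X ^ n ∣ f) : f = 0 :=
  PowerSeries.ext fun n => X_pow_dvd_iff.1 (h (n + 1)) n (Nat.lt_succ_self n)

end FormalDiff

namespace FormalDiff

/-! ### Commuting diffeomorphisms tangent to the identity -/

/-- With `f = x + u` and `g = x + v`, commutation reads `u(g) - u = v(f) - v`. If `a`, `b` are the
leading coefficients of `u`, `v`, degree `k + l + 1` gives `(k+1)ab = (l+1)ab`. -/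
theorem eq_of_commute_of_tangent {f g : FormalDiff} (hfg : f * g = g * f) {k l : ℕ}
    (hk : 1 ≤ k) (hl : 1 ≤ l) (hf : X ^ (k + 1) ∣ f.toSeries - X)
    (hg : X ^ (l + 1) ∣ g.toSeries - X) (hf0 : coeff (k + 1) (f.toSeries - X) ≠ 0)
    (hg0 : coeff (l + 1) (g.toSeries - X) ≠ 0) : k = l := by
  have hc : (f.toSeries.subst g.toSeries : ℂ⟦X⟧) = g.toSeries.subst f.toSeries :=
    congrArg toSeries hfg
  have e : ((f.toSeries - X).subst g.toSeries - (f.toSeries - X).subst X : ℂ⟦X⟧) =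
      (g.toSeries - X).subst f.toSeries - (g.toSeries - X).subst X := by
    rw [X_subst, X_subst, subst_sub g.hasSubst, subst_sub f.hasSubst, subst_X f.hasSubst,
      subst_X g.hasSubst, hc]
    ring
  have h1 := coeff_subst_sub_subst constantCoeff_X g.constantCoeff_eq hl hg hf
  have h2 := coeff_subst_sub_subst constantCoeff_X f.constantCoeff_eq hk hf hg
  rw [e, show k + 1 + l = l + 1 + k by omega, h2] at h1
  rw [coeff_one_X, one_pow, one_pow, mul_one, mul_one, mul_assoc, mul_assoc,
    mul_comm (coeff (l + 1) _)] at h1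
  have h3 := mul_right_cancel₀ (mul_ne_zero hf0 hg0) h1
  have h4 := add_right_cancel h3
  exact (Nat.cast_injective h4).symm

theorem exists_leading_term {f : FormalDiff} (h1 : coeff 1 f.toSeries = 1) (hf : f ≠ 1) :
    ∃ k, 1 ≤ k ∧ X ^ (k + 1) ∣ f.toSeries - X ∧ coeff (k + 1) (f.toSeries - X) ≠ 0 := by
  classical
  have hne : ∃ n, coeff n (f.toSeries - X) ≠ 0 := by
    by_contra! h
    exact hf (FormalDiff.ext (sub_eq_zero.1 (PowerSeries.ext h)))
  have hmin : ∀ i < Nat.find hne, coeff i (f.toSeries - X) = 0 := fun i hi =>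
    not_not.1 (Nat.find_min hne hi)
  have h0 := Nat.find_spec hne
  have hn0 : Nat.find hne ≠ 0 := fun h => by
    rw [h] at h0
    simp [f.constantCoeff_eq] at h0
  have hn1 : Nat.find hne ≠ 1 := fun h => by
    rw [h] at h0
    simp [h1] at h0
  obtain ⟨k, hk⟩ : ∃ k, Nat.find hne = k + 1 := Nat.exists_eq_succ_of_ne_zero hn0
  rw [hk] at h0 hmin hn1
  exact ⟨k, by omega, X_pow_dvd_iff.2 hmin, h0⟩

/-- If `f` is tangent to the identity to order `k`, an element commuting with `f` has a multiplier
that is a `k`-th root of unity. -/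
theorem coeff_one_pow_eq_one_of_commute {f g : FormalDiff} (hfg : f * g = g * f) {k : ℕ}
    (hk : 1 ≤ k) (hf : X ^ (k + 1) ∣ f.toSeries - X) (hf0 : coeff (k + 1) (f.toSeries - X) ≠ 0) :
    coeff 1 g.toSeries ^ k = 1 := by
  have hc : (f.toSeries.subst g.toSeries : ℂ⟦X⟧) = g.toSeries.subst f.toSeries :=
    congrArg toSeries hfg
  have e : ((f.toSeries - X).subst g.toSeries : ℂ⟦X⟧) =
      g.toSeries.subst f.toSeries - g.toSeries.subst X := by
    rw [subst_sub g.hasSubst, subst_X g.hasSubst, hc, X_subst]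
  -- If `a` is the leading coefficient of `f - x` and `c = g'(0)`, the two sides of `e` have
  -- coefficients `a c^(k+1)` and `c a` in degree `k + 1`.
  have h1 := coeff_subst_of_X_pow_dvd g.constantCoeff_eq hf
  have h2 := coeff_subst_sub_subst (p := 0) constantCoeff_X f.constantCoeff_eq hk hf
    (by simpa using X_dvd_iff.2 g.constantCoeff_eq)
  rw [e, add_comm k 1] at h1
  rw [zero_add, h1, add_comm k 1] at h2
  rw [add_comm k 1] at hf0
  simp only [Nat.cast_zero, zero_add, one_mul, pow_zero, mul_one] at h2
  rw [mul_comm] at h2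
  have h3 := mul_right_cancel₀ hf0 h2
  rw [pow_add, pow_one] at h3
  exact mul_left_cancel₀ g.coeff_one_ne (h3.trans (mul_one _).symm)

end FormalDiff

namespace FormalField

/-! ### Leading terms of the model flows -/

theorem X_pow_add_dvd_lieDeriv {a : ℂ⟦X⟧} {k : ℕ} (ha : X ^ (k + 1) ∣ a) {n : ℕ} {f : ℂ⟦X⟧}
    (hf : X ^ n ∣ f) : X ^ (n + k) ∣ lieDeriv a f := by
  obtain ⟨b, rfl⟩ := ha
  have h : X ^ n ∣ X * d⁄dX ℂ f := by
    rw [X_pow_dvd_iff] at hf ⊢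
    intro m hm
    cases m with
    | zero => simp
    | succ m => rw [coeff_succ_X_mul, coeff_derivative, hf _ hm, zero_mul]
  obtain ⟨c, hc⟩ := h
  refine ⟨b * c, ?_⟩
  calc X ^ (k + 1) * b * d⁄dX ℂ f = X ^ k * b * (X * d⁄dX ℂ f) := by ring
    _ = X ^ (n + k) * (b * c) := by rw [hc]; ring

theorem X_pow_dvd_iterate_lieDeriv_X {a : ℂ⟦X⟧} {k : ℕ} (ha : X ^ (k + 1) ∣ a) (n : ℕ) :
    X ^ (n * k + 1) ∣ (lieDeriv a)^[n] X := by
  induction n with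
  | zero => simp
  | succ n ih =>
    rw [Function.iterate_succ_apply']
    have := X_pow_add_dvd_lieDeriv ha ih
    rwa [show n * k + 1 + k = (n + 1) * k + 1 by ring] at this

theorem lieDeriv_X (a : ℂ⟦X⟧) : lieDeriv a X = a := by simp [lieDeriv]

/-- `Dⁿ x` has order at least `nk + 1`, so the terms with `n ≥ 3` start in degree `3k + 1 > 2k + 1`.
-/
theorem coeff_lieSeries_X {a : ℂ⟦X⟧} {k : ℕ} (hk : 1 ≤ k) (ha : X ^ (k + 1) ∣ a) (t : ℂ) {m : ℕ}
    (hm : m ≤ 2 * k + 1) : coeff m (lieSeries a t X) =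
      coeff m X + t * coeff m a + t ^ 2 / 2 * coeff m (lieDeriv a a) := by
  have ha2 : X ^ 2 ∣ a := (pow_dvd_pow X (by omega)).trans ha
  rw [coeff_lieSeries ha2 t X (show m < m + 3 by omega),
    ← Finset.sum_subset (Finset.range_mono (show 3 ≤ m + 3 by omega))]
  · simp [Finset.sum_range_succ, lieDeriv_X]
  · intro n _ hn
    rw [Finset.mem_range, not_lt] at hn
    have := Nat.mul_le_mul_right k hn
    rw [X_pow_dvd_iff.1 (X_pow_dvd_iterate_lieDeriv_X ha n) m (by omega), mul_zero]

theorem X_pow_dvd_modelField (k : ℕ) (lam : ℂ) : X ^ (k + 1) ∣ modelField k lam :=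
  dvd_mul_right _ _

/-- The field satisfies `a = x^(k+1) - lam x^k a`; this is iterated twice, and the remainder `lam²
x^(2k) a` has order at least `3k + 1 ≥ 2k + 2`. -/
theorem exists_modelField_eq {k : ℕ} (hk : 1 ≤ k) (lam : ℂ) : ∃ r : ℂ⟦X⟧,
    modelField k lam = X ^ (k + 1) - lam • X ^ (2 * k + 1) + X ^ (2 * k + 2) * r := by
  have h := modelField_mul hk lam
  obtain ⟨u, hu⟩ := X_pow_dvd_modelField k lam
  obtain ⟨j, rfl⟩ : ∃ j, k = j + 1 := ⟨k - 1, by omega⟩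
  refine ⟨lam ^ 2 • (X ^ j * u), ?_⟩
  have hm : modelField (j + 1) lam = X ^ (j + 1 + 1) - C lam * X ^ (j + 1) * modelField (j + 1) lam := by
    rw [← h]; ring
  rw [smul_eq_C_mul, smul_eq_C_mul, map_pow]
  calc modelField (j + 1) lam
      = X ^ (j + 1 + 1) - C lam * X ^ (j + 1) *
        (X ^ (j + 1 + 1) - C lam * X ^ (j + 1) * modelField (j + 1) lam) := by rw [← hm, ← hm]
    _ = _ := by rw [hu]; ring

theorem coeff_modelField {k : ℕ} (hk : 1 ≤ k) (lam : ℂ) {m : ℕ} (hm : m ≤ 2 * k + 1) :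
    coeff m (modelField k lam) =
      (if m = k + 1 then 1 else 0) - (if m = 2 * k + 1 then lam else 0) := by
  obtain ⟨r, hr⟩ := exists_modelField_eq hk lam
  rw [hr, map_add, X_pow_dvd_iff.1 (dvd_mul_right _ r) m (by omega), map_sub, coeff_smul,
    coeff_X_pow, coeff_X_pow]
  simp

/-- The parameter enters the field only from degree `2k + 1`, hence enters `D² x` only from degree
`3k + 1`. -/
theorem coeff_lieDeriv_modelField {k : ℕ} (hk : 1 ≤ k) (lam : ℂ) {m : ℕ} (hm : m ≤ 2 * k + 1) :
    coeff m (lieDeriv (modelField k lam) (modelField k lam)) =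
      coeff m (lieDeriv (X ^ (k + 1)) (X ^ (k + 1))) := by
  obtain ⟨r, hr⟩ := exists_modelField_eq hk lam
  set s : ℂ⟦X⟧ := X * r - C lam with hs
  have h1 : modelField k lam = X ^ (k + 1) + X ^ (2 * k + 1) * s := by
    rw [hr, smul_eq_C_mul]; ring
  have h2 : X ^ (2 * k + 1 + k) ∣ lieDeriv (modelField k lam) (X ^ (2 * k + 1) * s) :=
    X_pow_add_dvd_lieDeriv (X_pow_dvd_modelField k lam) (dvd_mul_right _ _)
  have h3 : X ^ (k + 1 + 2 * k) ∣ lieDeriv (X ^ (2 * k + 1) * s) (X ^ (k + 1)) :=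
    X_pow_add_dvd_lieDeriv (dvd_mul_right _ _) dvd_rfl
  have e : lieDeriv (modelField k lam) (modelField k lam) =
      lieDeriv (X ^ (k + 1)) (X ^ (k + 1)) + lieDeriv (X ^ (2 * k + 1) * s) (X ^ (k + 1)) +
        lieDeriv (modelField k lam) (X ^ (2 * k + 1) * s) := by
    conv_lhs => rw [lieDeriv]; arg 2; rw [h1]
    rw [map_add, mul_add]
    conv_lhs => arg 1; rw [h1, add_mul]
    rfl
  rw [e, map_add, map_add, X_pow_dvd_iff.1 h2 m (by omega), X_pow_dvd_iff.1 h3 m (by omega)]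
  simp

/-- The time-`t` map of the model field. -/
theorem coeff_lieSeries_modelField {k : ℕ} (hk : 1 ≤ k) (lam t : ℂ) {m : ℕ}
    (hm : m ≤ 2 * k + 1) : coeff m (lieSeries (modelField k lam) t X) =
      coeff m (lieSeries (modelField k 0) t X) - (if m = 2 * k + 1 then t * lam else 0) := by
  rw [coeff_lieSeries_X hk (X_pow_dvd_modelField k lam) t hm,
    coeff_lieSeries_X hk (X_pow_dvd_modelField k 0) t hm, coeff_modelField hk lam hm,
    coeff_modelField hk 0 hm, coeff_lieDeriv_modelField hk lam hm,
    coeff_lieDeriv_modelField hk 0 hm]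
  split_ifs <;> ring

theorem coeff_lieSeries_modelField_sub_X {k : ℕ} (hk : 1 ≤ k) (lam t : ℂ) {m : ℕ}
    (hm : m ≤ k + 1) : coeff m (lieSeries (modelField k lam) t X - X) =
      if m = k + 1 then t else 0 := by
  have h : X ^ (k + 1 + k) ∣ lieDeriv (modelField k lam) (modelField k lam) :=
    X_pow_add_dvd_lieDeriv (X_pow_dvd_modelField k lam) (X_pow_dvd_modelField k lam)
  rw [map_sub, coeff_lieSeries_X hk (X_pow_dvd_modelField k lam) t (by omega),
    coeff_modelField hk lam (by omega), X_pow_dvd_iff.1 h m (by omega),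
    if_neg (show m ≠ 2 * k + 1 by omega)]
  split_ifs <;> ring

theorem X_pow_dvd_lieSeries_modelField_sub_X {k : ℕ} (hk : 1 ≤ k) (lam t : ℂ) :
    X ^ (k + 1) ∣ lieSeries (modelField k lam) t X - X := by
  rw [X_pow_dvd_iff]
  intro m hm
  rw [coeff_lieSeries_modelField_sub_X hk lam t hm.le, if_neg hm.ne]

end FormalField

namespace FormalDiff

open FormalField

/-! ### Normal form of diffeomorphisms tangent to the identity -/

/-- The effect of adding `β x^(l+1)` to `φ` on the conjugacy defect `φ ∘ f - F ∘ φ`. -/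
theorem conjugacy_defect_add {f F φ : ℂ⟦X⟧} {k l : ℕ} (hk : 1 ≤ k) (hl : 1 ≤ l)
    (hf : X ^ (k + 1) ∣ f - X) (hF : X ^ (k + 1) ∣ F - X) (hF1 : coeff (k + 1) (F - X) = 1)
    (hφ : constantCoeff φ = 0) (hφ1 : coeff 1 φ ^ k = coeff (k + 1) (f - X))
    (hd : X ^ (k + l + 1) ∣ (φ.subst f - F.subst φ : ℂ⟦X⟧)) (β : ℂ) :
    X ^ (k + l + 1) ∣ ((φ + β • X ^ (l + 1)).subst f - F.subst (φ + β • X ^ (l + 1)) : ℂ⟦X⟧) ∧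
    coeff (k + l + 1) ((φ + β • X ^ (l + 1)).subst f - F.subst (φ + β • X ^ (l + 1)) : ℂ⟦X⟧) =
      coeff (k + l + 1) (φ.subst f - F.subst φ : ℂ⟦X⟧) +
        β * coeff (k + 1) (f - X) * ((l : ℂ) - k) := by
  have hf0 : constantCoeff f = 0 := by
    obtain ⟨u, hu⟩ := hf
    rw [sub_eq_iff_eq_add.1 hu]
    simp
  have hs : HasSubst f := HasSubst.of_constantCoeff_zero' hf0
  set w : ℂ⟦X⟧ := β • X ^ (l + 1) with hw
  have hwd : X ^ (l + 1) ∣ w := by rw [hw, smul_eq_C_mul]; exact dvd_mul_left _ _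
  have hwc : coeff (l + 1) w = β := by simp [hw]
  have hφ' : constantCoeff (φ + w) = 0 := by simp [hw, hφ]
  have hsφ : HasSubst φ := HasSubst.of_constantCoeff_zero' hφ
  have hsφ' : HasSubst (φ + w) := HasSubst.of_constantCoeff_zero' hφ'
  have hwd' : X ^ (l + 1) ∣ (φ + w) - φ := by simpa using hwd
  have a1 := X_pow_dvd_subst_sub_subst_of_dvd constantCoeff_X hf0 hk hf hwd
  have a2 := coeff_subst_sub_subst constantCoeff_X hf0 hk hf hwd
  have b1 := X_pow_dvd_subst_sub_subst_of_dvd hφ hφ' hl hwd' hF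
  have b2 := coeff_subst_sub_subst hφ hφ' hl hwd' hF
  -- To first order, with `a` the leading coefficient of `f - x`, the term `w ∘ f - w` contributes
  -- `(l+1) β a` and the `F` side `(k+1) φ'(0)^k β`. Since `φ'(0)^k = a`, the difference is `(l - k)
  -- β a`.
  have e : ((φ + w).subst f - F.subst (φ + w) : ℂ⟦X⟧) = (φ.subst f - F.subst φ) +
      ((w.subst f - w.subst X) - ((F - X).subst (φ + w) - (F - X).subst φ)) := by
    rw [subst_add hs, X_subst, subst_sub hsφ, subst_sub hsφ', subst_X hsφ, subst_X hsφ']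
    ring
  rw [show l + 1 + k = k + l + 1 by omega] at a1 a2
  rw [show k + 1 + l = k + l + 1 by omega] at b1 b2
  rw [e]
  refine ⟨hd.add (a1.sub b1), ?_⟩
  rw [map_add, add_right_inj, map_sub, a2, b2, add_sub_cancel_left, hwc, hF1, coeff_one_X, hφ1]
  ring

/-- Off the resonance `l = k` the factor `l - k` is invertible, so some `β` removes the next term of
the defect. -/
theorem exists_conjugacy_step {f F φ : ℂ⟦X⟧} {k l : ℕ} (hk : 1 ≤ k) (hl : 1 ≤ l) (hkl : l ≠ k)
    (hf : X ^ (k + 1) ∣ f - X) (hf1 : coeff (k + 1) (f - X) ≠ 0)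
    (hF : X ^ (k + 1) ∣ F - X) (hF1 : coeff (k + 1) (F - X) = 1)
    (hφ : constantCoeff φ = 0) (hφ1 : coeff 1 φ ^ k = coeff (k + 1) (f - X))
    (hd : X ^ (k + l + 1) ∣ (φ.subst f - F.subst φ : ℂ⟦X⟧)) :
    ∃ ψ : ℂ⟦X⟧, constantCoeff ψ = 0 ∧ coeff 1 ψ ^ k = coeff (k + 1) (f - X) ∧
      X ^ (k + (l + 1) + 1) ∣ (ψ.subst f - F.subst ψ : ℂ⟦X⟧) ∧ X ^ (l + 1) ∣ ψ - φ := by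
  have hlk : (l : ℂ) - k ≠ 0 := sub_ne_zero.2 (Nat.cast_injective.ne hkl)
  set β : ℂ := -coeff (k + l + 1) (φ.subst f - F.subst φ : ℂ⟦X⟧) /
    (coeff (k + 1) (f - X) * ((l : ℂ) - k)) with hβ
  obtain ⟨h1, h2⟩ := conjugacy_defect_add hk hl hf hF hF1 hφ hφ1 hd β
  rw [mul_assoc, hβ, div_mul_cancel₀ _ (mul_ne_zero hf1 hlk), add_neg_cancel, ← hβ] at h2
  refine ⟨φ + β • X ^ (l + 1), by simp [hφ], ?_, ?_, ?_⟩
  · rw [map_add, coeff_smul, coeff_X_pow, if_neg (by omega), smul_zero, add_zero, hφ1]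
  · rw [X_pow_dvd_iff]
    intro m hm
    rcases Nat.lt_or_ge m (k + l + 1) with h | h
    · exact X_pow_dvd_iff.1 h1 m h
    · rw [show m = k + l + 1 by omega]
      exact h2
  · rw [add_sub_cancel_left, smul_eq_C_mul]
    exact dvd_mul_left _ _

theorem exists_conjugacy_modelField {f : FormalDiff} {k : ℕ} (hk : 1 ≤ k)
    (hf : X ^ (k + 1) ∣ f.toSeries - X) (hf1 : coeff (k + 1) (f.toSeries - X) ≠ 0) :
    ∃ (lam : ℂ) (φ : FormalDiff),
      φ * f = flow (modelField k lam) (X_sq_dvd_modelField hk lam) (Multiplicative.ofAdd 1) * φ := by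
  set F : ℂ → ℂ⟦X⟧ := fun lam => lieSeries (modelField k lam) 1 X with hFdef
  set u : ℂ⟦X⟧ := f.toSeries with hu
  have hu0 : constantCoeff u = 0 := f.constantCoeff_eq
  have hF : ∀ lam, X ^ (k + 1) ∣ F lam - X := fun lam =>
    X_pow_dvd_lieSeries_modelField_sub_X hk lam 1
  have hF1 : ∀ lam, coeff (k + 1) (F lam - X) = 1 := fun lam => by
    rw [hFdef, coeff_lieSeries_modelField_sub_X hk lam 1 le_rfl, if_pos rfl]
  have hFdiff : ∀ lam, X ^ (2 * k + 1) ∣ F lam - F 0 ∧ coeff (2 * k + 1) (F lam - F 0) = -lam := by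
    intro lam
    constructor
    · rw [X_pow_dvd_iff]
      intro m hm
      rw [map_sub, coeff_lieSeries_modelField hk lam 1 hm.le, if_neg hm.ne]
      ring
    · rw [map_sub, coeff_lieSeries_modelField hk lam 1 le_rfl, if_pos rfl]
      ring
  -- The homothety of ratio `r` matches the coefficients of degree `k + 1`.
  obtain ⟨r, hr⟩ := IsAlgClosed.exists_pow_nat_eq (coeff (k + 1) (u - X)) (show 0 < k from hk)
  have hr0 : r ≠ 0 := by
    rintro rfl
    rw [zero_pow (by omega)] at hr
    exact hf1 hr.symm
  let P : ℂ → ℕ → ℂ⟦X⟧ → Prop := fun lam l φ => constantCoeff φ = 0 ∧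
    coeff 1 φ ^ k = coeff (k + 1) (u - X) ∧ X ^ (k + l + 1) ∣ (φ.subst u - (F lam).subst φ : ℂ⟦X⟧)
  have hstart : P 0 1 (r • X) := by
    have hs : HasSubst (r • X : ℂ⟦X⟧) := HasSubst.smul_X' r
    have h0 : constantCoeff (r • X : ℂ⟦X⟧) = 0 := by simp
    refine ⟨h0, by simp [hr], ?_⟩
    have e : ((r • X : ℂ⟦X⟧).subst u - (F 0).subst (r • X : ℂ⟦X⟧) : ℂ⟦X⟧) =
        r • (u - X) - (F 0 - X).subst (r • X : ℂ⟦X⟧) := by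
      rw [subst_smul f.hasSubst, subst_X f.hasSubst, subst_sub hs, subst_X hs, smul_sub]
      ring
    have hd := X_pow_dvd_subst h0 (hF 0)
    have hc := coeff_subst_of_X_pow_dvd h0 (hF 0)
    rw [e, X_pow_dvd_iff]
    intro m hm
    rcases Nat.lt_or_ge m (k + 1) with h | h
    · rw [map_sub, coeff_smul, X_pow_dvd_iff.1 hf m h, X_pow_dvd_iff.1 hd m h, smul_zero, sub_zero]
    · rw [show m = k + 1 by omega, map_sub, coeff_smul, hc, hF1, ← hr]
      simp
      ring
  have hlow : ∀ l, 1 ≤ l → l ≤ k → ∃ φ, P 0 l φ := by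
    intro l hl
    induction l, hl using Nat.le_induction with
    | base => exact fun _ => ⟨_, hstart⟩
    | succ l hl ih =>
      intro hlk
      obtain ⟨φ, h0, h1, h2⟩ := ih (by omega)
      obtain ⟨ψ, h3, h4, h5, -⟩ :=
        exists_conjugacy_step hk hl (by omega) hf hf1 (hF 0) (hF1 0) h0 h1 h2
      exact ⟨ψ, h3, h4, h5⟩
  obtain ⟨φ, h0, h1, h2⟩ := hlow k hk le_rfl
  have hφne : coeff 1 φ ≠ 0 := fun h => by
    rw [h, zero_pow (by omega)] at h1
    exact hf1 h1.symm
  -- The resonant stage: changing `φ` no longer moves the coefficient of degree `2k + 1`, but `F lam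
  -- ∘ φ - F 0 ∘ φ` starts with `-lam φ'(0)^(2k+1)` exactly there, leaving lower degrees intact.
  obtain ⟨lam, hlam⟩ : ∃ lam : ℂ, P lam (k + 1) φ := by
    refine ⟨-coeff (2 * k + 1) (φ.subst u - (F 0).subst φ : ℂ⟦X⟧) / coeff 1 φ ^ (2 * k + 1),
      h0, h1, ?_⟩
    set lam := -coeff (2 * k + 1) (φ.subst u - (F 0).subst φ : ℂ⟦X⟧) / coeff 1 φ ^ (2 * k + 1)
      with hlam
    have hs : HasSubst φ := HasSubst.of_constantCoeff_zero' h0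
    have hd := X_pow_dvd_subst h0 (hFdiff lam).1
    have hc := coeff_subst_of_X_pow_dvd h0 (hFdiff lam).1
    have e : (φ.subst u - (F lam).subst φ : ℂ⟦X⟧) = (φ.subst u - (F 0).subst φ) -
        (F lam - F 0).subst φ := by
      rw [subst_sub hs]
      ring
    rw [show k + k + 1 = 2 * k + 1 by omega] at h2
    rw [e, X_pow_dvd_iff]
    intro m hm
    rcases Nat.lt_or_ge m (2 * k + 1) with h | h
    · rw [map_sub, X_pow_dvd_iff.1 h2 m h, X_pow_dvd_iff.1 hd m h, sub_zero]
    · rw [show m = 2 * k + 1 by omega, map_sub, hc, (hFdiff lam).2, hlam, neg_div, neg_neg,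
        div_mul_cancel₀ _ (pow_ne_zero _ hφne), sub_self]
  -- The index `k + 1 + n` stays beyond the resonance, so every step is available.
  obtain ⟨Φ, hΦ⟩ := exists_X_adic_limit (fun n => P lam (k + 1 + n)) hlam
    (fun n ψ hψ => by
      obtain ⟨χ, h3, h4, h5, h6⟩ := exists_conjugacy_step hk (show 1 ≤ k + 1 + n by omega)
        (by omega) hf hf1 (hF lam) (hF1 lam) hψ.1 hψ.2.1 hψ.2.2
      exact ⟨χ, ⟨h3, h4, h5⟩, (pow_dvd_pow X (by omega)).trans h6⟩)
  have hΦ0 : constantCoeff Φ = 0 := by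
    obtain ⟨ψ, hψ, hd⟩ := hΦ 1
    have := X_pow_dvd_iff.1 hd 0 (by omega)
    rwa [map_sub, coeff_zero_eq_constantCoeff_apply, coeff_zero_eq_constantCoeff_apply, hψ.1,
      sub_zero] at this
  have hΦ1 : coeff 1 Φ ≠ 0 := by
    obtain ⟨ψ, hψ, hd⟩ := hΦ 2
    have := X_pow_dvd_iff.1 hd 1 (by omega)
    rw [map_sub, sub_eq_zero] at this
    intro h
    have h3 := hψ.2.1
    rw [← this, h, zero_pow (by omega)] at h3
    exact hf1 h3.symm
  refine ⟨lam, ⟨Φ, hΦ0, hΦ1⟩, FormalDiff.ext ?_⟩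
  change (Φ.subst u : ℂ⟦X⟧) = (F lam).subst Φ
  refine sub_eq_zero.1 (eq_zero_of_forall_X_pow_dvd fun n => ?_)
  obtain ⟨ψ, hψ, hd⟩ := hΦ n
  have e : (Φ.subst u - (F lam).subst Φ : ℂ⟦X⟧) = (Φ - ψ).subst u +
      (ψ.subst u - (F lam).subst ψ) - ((F lam).subst Φ - (F lam).subst ψ) := by
    rw [subst_sub f.hasSubst]
    ring
  rw [e]
  exact ((X_pow_dvd_subst hu0 hd).add ((pow_dvd_pow X (by omega)).trans hψ.2.2)).sub
    (X_pow_dvd_subst_sub_subst hψ.1 hΦ0 hd _)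

end FormalDiff

namespace FormalDiff

open FormalField

/-! ### Linearisation of commuting families -/

/-- The multiplier `f ↦ f'(0)`. -/
noncomputable def multiplier : FormalDiff →* ℂˣ where
  toFun f := Units.mk0 (coeff 1 f.toSeries) f.coeff_one_ne
  map_one' := Units.ext (by simp [one_toSeries])
  map_mul' f g := Units.ext (coeff_one_subst g.constantCoeff_eq)

theorem coe_multiplier (f : FormalDiff) : (multiplier f : ℂ) = coeff 1 f.toSeries := rfl

theorem multiplier_homothety (κ : ℂˣ) : multiplier (homothety κ) = κ :=
  Units.ext (by simp [coe_multiplier, homothety_toSeries])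

/-- `φ` conjugates `h` to its linear part if and only if `φ ∘ h = h'(0) φ`. -/
theorem mul_eq_homothety_mul_iff (φ h : FormalDiff) :
    φ * h = homothety (multiplier h) * φ ↔
      (φ.toSeries.subst h.toSeries : ℂ⟦X⟧) = coeff 1 h.toSeries • φ.toSeries := by
  have e : (homothety (multiplier h) * φ).toSeries = coeff 1 h.toSeries • φ.toSeries := by
    rw [mul_toSeries, homothety_toSeries, subst_smul φ.hasSubst, subst_X φ.hasSubst,
      coe_multiplier]
  rw [FormalDiff.ext_iff, e, mul_toSeries]

theorem coeff_subst_smul_X_pow {h : ℂ⟦X⟧} (hh : constantCoeff h = 0) (β : ℂ) (n : ℕ) :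
    X ^ n ∣ ((β • X ^ n : ℂ⟦X⟧).subst h - coeff 1 h • (β • X ^ n : ℂ⟦X⟧) : ℂ⟦X⟧) ∧
    coeff n ((β • X ^ n : ℂ⟦X⟧).subst h - coeff 1 h • (β • X ^ n : ℂ⟦X⟧) : ℂ⟦X⟧) =
      β * (coeff 1 h ^ n - coeff 1 h) := by
  have hd : X ^ n ∣ (β • X ^ n : ℂ⟦X⟧) := by rw [smul_eq_C_mul]; exact dvd_mul_left _ _
  refine ⟨(X_pow_dvd_subst hh hd).sub ?_, ?_⟩
  · rw [smul_eq_C_mul]; exact hd.mul_left _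
  · rw [map_sub, coeff_subst_of_X_pow_dvd hh hd]
    simp
    ring

/-- Put `L_h ψ = ψ ∘ h - h'(0) ψ`. The coefficient `β` kills the degree `n` term of `L_{h₀} ψ` for
one `h₀` with `c^n ≠ c`, where `c = h₀'(0)`. Since `L_{h₀} L_h ψ = L_h L_{h₀} ψ` then has order
above `n`, while its degree `n` coefficient is `c^n - c` times that of `L_h ψ`, the same `β` works
for all `h`. -/
theorem exists_linearization_step {H : Set FormalDiff} (hH : ∀ f ∈ H, ∀ g ∈ H, f * g = g * f)
    {n : ℕ} (hn : 2 ≤ n) (hmult : ∃ h ∈ H, coeff 1 h.toSeries ^ (n - 1) ≠ 1) {φ : ℂ⟦X⟧}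
    (hφ : ∀ h ∈ H, X ^ n ∣ (φ.subst h.toSeries - coeff 1 h.toSeries • φ : ℂ⟦X⟧)) :
    ∃ ψ : ℂ⟦X⟧, (∀ h ∈ H, X ^ (n + 1) ∣ (ψ.subst h.toSeries - coeff 1 h.toSeries • ψ : ℂ⟦X⟧)) ∧
      X ^ n ∣ ψ - φ := by
  obtain ⟨h₀, hh₀, hc⟩ := hmult
  set c := coeff 1 h₀.toSeries with hcdef
  have hcc : c ^ n - c ≠ 0 := by
    intro h
    apply hc
    apply mul_left_cancel₀ h₀.coeff_one_ne
    rw [← hcdef, ← pow_succ', Nat.sub_add_cancel (by omega), mul_one]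
    exact sub_eq_zero.1 h
  set β : ℂ := -coeff n (φ.subst h₀.toSeries - c • φ : ℂ⟦X⟧) / (c ^ n - c) with hβ
  set ψ : ℂ⟦X⟧ := φ + β • X ^ n with hψ
  have hsplit : ∀ h : FormalDiff, (ψ.subst h.toSeries - coeff 1 h.toSeries • ψ : ℂ⟦X⟧) =
      (φ.subst h.toSeries - coeff 1 h.toSeries • φ) +
      ((β • X ^ n : ℂ⟦X⟧).subst h.toSeries - coeff 1 h.toSeries • (β • X ^ n : ℂ⟦X⟧)) := by
    intro h
    rw [hψ, subst_add h.hasSubst, smul_add]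
    ring
  have hd : ∀ h ∈ H, X ^ n ∣ (ψ.subst h.toSeries - coeff 1 h.toSeries • ψ : ℂ⟦X⟧) := by
    intro h hh
    rw [hsplit]
    exact (hφ h hh).add (coeff_subst_smul_X_pow h.constantCoeff_eq β n).1
  have hd₀ : X ^ (n + 1) ∣ (ψ.subst h₀.toSeries - c • ψ : ℂ⟦X⟧) := by
    rw [X_pow_dvd_iff]
    intro m hm
    rcases Nat.lt_or_ge m n with h | h
    · exact X_pow_dvd_iff.1 (hd h₀ hh₀) m h
    · rw [show m = n by omega, hsplit, map_add,
        (coeff_subst_smul_X_pow h₀.constantCoeff_eq β n).2, ← hcdef, hβ, div_mul_cancel₀ _ hcc,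
        add_neg_cancel]
  refine ⟨ψ, fun h hh => ?_, ?_⟩
  · have hcomm : (h₀.toSeries.subst h.toSeries : ℂ⟦X⟧) = h.toSeries.subst h₀.toSeries :=
      congrArg toSeries (hH h₀ hh₀ h hh)
    set d := coeff 1 h.toSeries with hddef
    have e : (subst h₀.toSeries (ψ.subst h.toSeries - d • ψ : ℂ⟦X⟧) -
        c • (ψ.subst h.toSeries - d • ψ) : ℂ⟦X⟧) =
        subst h.toSeries (ψ.subst h₀.toSeries - c • ψ : ℂ⟦X⟧) - d • (ψ.subst h₀.toSeries - c • ψ) := by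
      rw [subst_sub h.hasSubst, subst_sub h₀.hasSubst, subst_smul h.hasSubst,
        subst_smul h₀.hasSubst, subst_comp_subst_apply h.hasSubst h₀.hasSubst,
        subst_comp_subst_apply h₀.hasSubst h.hasSubst, hcomm, smul_sub, smul_sub,
        smul_comm c d ψ]
      abel
    have h1 : X ^ (n + 1) ∣ (subst h.toSeries (ψ.subst h₀.toSeries - c • ψ : ℂ⟦X⟧) -
        d • (ψ.subst h₀.toSeries - c • ψ) : ℂ⟦X⟧) := by
      refine (X_pow_dvd_subst h.constantCoeff_eq hd₀).sub ?_
      rw [smul_eq_C_mul]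
      exact hd₀.mul_left _
    rw [← e] at h1
    have h2 := X_pow_dvd_iff.1 h1 n (Nat.lt_succ_self n)
    rw [map_sub, coeff_subst_of_X_pow_dvd h₀.constantCoeff_eq (hd h hh), coeff_smul, smul_eq_mul,
      mul_comm c, ← mul_sub, ← hcdef] at h2
    have h3 := (mul_eq_zero.1 h2).resolve_right hcc
    rw [X_pow_dvd_iff]
    intro m hm
    rcases Nat.lt_or_ge m n with h | h
    · exact X_pow_dvd_iff.1 (hd _ hh) m h
    · rw [show m = n by omega]
      exact h3
  · rw [hψ, add_sub_cancel_left, smul_eq_C_mul]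
    exact dvd_mul_left _ _

/-- A commuting family whose multipliers have no common finite order is linearisable. -/
theorem exists_linearization_of_unbounded {H : Set FormalDiff}
    (hH : ∀ f ∈ H, ∀ g ∈ H, f * g = g * f)
    (hmult : ∀ m, 1 ≤ m → ∃ h ∈ H, multiplier h ^ m ≠ 1) :
    ∃ φ : FormalDiff, ∀ h ∈ H, φ * h = homothety (multiplier h) * φ := by
  have hmult' : ∀ m, 1 ≤ m → ∃ h ∈ H, coeff 1 h.toSeries ^ m ≠ 1 := fun m hm => by
    obtain ⟨h, hh, hne⟩ := hmult m hm
    refine ⟨h, hh, fun h1 => hne (Units.ext ?_)⟩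
    rw [Units.val_pow_eq_pow_val, coe_multiplier, h1, Units.val_one]
  -- The offset `2` makes the series `x` a valid start, and only degrees `≥ 2` need correcting.
  let P : ℕ → ℂ⟦X⟧ → Prop := fun n φ => constantCoeff φ = 0 ∧ coeff 1 φ = 1 ∧
    ∀ h ∈ H, X ^ (n + 2) ∣ (φ.subst h.toSeries - coeff 1 h.toSeries • φ : ℂ⟦X⟧)
  have hstart : P 0 X := by
    refine ⟨constantCoeff_X, coeff_one_X, fun h _ => ?_⟩
    rw [subst_X h.hasSubst, X_pow_dvd_iff]
    intro m hm
    interval_cases m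
    · simp [h.constantCoeff_eq]
    · simp
  obtain ⟨Φ, hΦ⟩ := exists_X_adic_limit P hstart (fun n ψ hψ => by
    obtain ⟨χ, h1, h2⟩ := exists_linearization_step hH (show 2 ≤ n + 2 by omega)
      (hmult' _ (by omega)) hψ.2.2
    have h3 := X_pow_dvd_iff.1 h2 0 (by omega)
    have h4 := X_pow_dvd_iff.1 h2 1 (by omega)
    rw [map_sub, sub_eq_zero] at h3 h4
    refine ⟨χ, ⟨?_, h4.trans hψ.2.1, fun h hh => ?_⟩, (pow_dvd_pow X (by omega)).trans h2⟩
    · rw [← coeff_zero_eq_constantCoeff_apply, h3, coeff_zero_eq_constantCoeff_apply, hψ.1]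
    · exact h1 h hh)
  have hΦ0 : constantCoeff Φ = 0 := by
    obtain ⟨ψ, hψ, hd⟩ := hΦ 1
    have := X_pow_dvd_iff.1 hd 0 (by omega)
    rwa [map_sub, coeff_zero_eq_constantCoeff_apply, coeff_zero_eq_constantCoeff_apply, hψ.1,
      sub_zero] at this
  have hΦ1 : coeff 1 Φ = 1 := by
    obtain ⟨ψ, hψ, hd⟩ := hΦ 2
    have := X_pow_dvd_iff.1 hd 1 (by omega)
    rwa [map_sub, hψ.2.1, sub_eq_zero] at this
  refine ⟨⟨Φ, hΦ0, by simp [hΦ1]⟩, fun h hh => (mul_eq_homothety_mul_iff _ _).2 ?_⟩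
  refine sub_eq_zero.1 (eq_zero_of_forall_X_pow_dvd fun n => ?_)
  obtain ⟨ψ, hψ, hd⟩ := hΦ n
  have e : (Φ.subst h.toSeries - coeff 1 h.toSeries • Φ : ℂ⟦X⟧) =
      (Φ - ψ).subst h.toSeries + (ψ.subst h.toSeries - coeff 1 h.toSeries • ψ) -
        coeff 1 h.toSeries • (Φ - ψ) := by
    rw [subst_sub h.hasSubst, smul_sub]
    ring
  change X ^ n ∣ (Φ.subst h.toSeries - coeff 1 h.toSeries • Φ : ℂ⟦X⟧)
  rw [e]
  refine ((X_pow_dvd_subst h.constantCoeff_eq hd).add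
    ((pow_dvd_pow X (by omega)).trans (hψ.2.2 h hh))).sub ?_
  rw [smul_eq_C_mul]
  exact hd.mul_left _

/-- A finite group of formal diffeomorphisms is linearisable. -/
theorem exists_linearization_of_finite (H : Subgroup FormalDiff) [Finite H] :
    ∃ φ : FormalDiff, ∀ h ∈ H, φ * h = homothety (multiplier h) * φ := by
  have := Fintype.ofFinite H
  -- Average of `h'(0)⁻¹ h`: composing with `g` on the right permutes the summands up to the factor
  -- `g'(0)`, and the linear coefficient is the order of `H`, nonzero in `ℂ`.
  let Φ : ℂ⟦X⟧ := ∑ h : H, (coeff 1 (h : FormalDiff).toSeries)⁻¹ • (h : FormalDiff).toSeries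
  have hΦ0 : constantCoeff Φ = 0 := by
    simp only [Φ, map_sum, smul_eq_C_mul, map_mul, (_ : FormalDiff).constantCoeff_eq, mul_zero,
      Finset.sum_const_zero]
  have hΦ1 : coeff 1 Φ ≠ 0 := by
    have : coeff 1 Φ = (Fintype.card H : ℂ) := by
      simp only [Φ, map_sum, coeff_smul, smul_eq_mul, inv_mul_cancel₀ (_ : FormalDiff).coeff_one_ne]
      simp
    rw [this]
    exact Nat.cast_ne_zero.2 Fintype.card_ne_zero
  refine ⟨⟨Φ, hΦ0, hΦ1⟩, fun g hg => (mul_eq_homothety_mul_iff _ _).2 ?_⟩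
  change (Φ.subst g.toSeries : ℂ⟦X⟧) = coeff 1 g.toSeries • Φ
  rw [← coe_substAlgHom g.hasSubst, map_sum, Finset.smul_sum,
    ← Equiv.sum_comp (Equiv.mulRight (⟨g, hg⟩ : H))
      (fun h : H => coeff 1 g.toSeries • (coeff 1 (h : FormalDiff).toSeries)⁻¹ •
        (h : FormalDiff).toSeries)]
  refine Finset.sum_congr rfl fun h _ => ?_
  rw [coe_substAlgHom g.hasSubst, subst_smul g.hasSubst, Equiv.coe_mulRight, Subgroup.coe_mul,
    mul_toSeries, coeff_one_subst g.constantCoeff_eq, smul_smul, mul_inv, mul_left_comm,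
    mul_inv_cancel₀ g.coeff_one_ne, mul_one]

theorem exists_linearization {H : Subgroup FormalDiff} (hH : ∀ f ∈ H, ∀ g ∈ H, f * g = g * f)
    (hinj : ∀ h ∈ H, multiplier h = 1 → h = 1) :
    ∃ φ : FormalDiff, ∀ h ∈ H, φ * h = homothety (multiplier h) * φ := by
  by_cases hm : ∀ m, 1 ≤ m → ∃ h ∈ H, multiplier h ^ m ≠ 1
  · exact exists_linearization_of_unbounded (H := (H : Set FormalDiff)) hH hm
  · push Not at hm
    obtain ⟨m, hm1, hm⟩ := hm
    have : NeZero m := ⟨by omega⟩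
    have hker : Function.Injective (multiplier.comp H.subtype) := by
      rw [injective_iff_map_eq_one]
      exact fun h hh => Subtype.ext (hinj h h.2 hh)
    have : Finite H := Finite.of_injective
      (fun h : H => (⟨multiplier (h : FormalDiff), (mem_rootsOfUnity m _).2 (hm h h.2)⟩ :
        rootsOfUnity m ℂ))
      (fun a b hab => hker (congrArg Subtype.val hab))
    exact exists_linearization_of_finite H

/-! ### Centralizers in the model subgroups -/

theorem mem_subgroupA_iff {k : ℕ} (hk : 1 ≤ k) (lam : ℂ) (g : FormalDiff) :
    g ∈ subgroupA k hk lam ↔ ∃ (t : Multiplicative ℂ) (ξ : ℂˣ), ξ ^ k = 1 ∧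
      flow (modelField k lam) (X_sq_dvd_modelField hk lam) t * homothety ξ = g := by
  constructor
  · rintro ⟨⟨t, ξ⟩, rfl⟩
    exact ⟨t, ξ, (mem_rootsOfUnity k _).1 ξ.2, rfl⟩
  · rintro ⟨t, ξ, hξ, rfl⟩
    exact ⟨⟨t, ⟨ξ, (mem_rootsOfUnity k _).2 hξ⟩⟩, rfl⟩

theorem subgroupA_commute {k : ℕ} (hk : 1 ≤ k) (lam : ℂ) :
    ∀ f ∈ subgroupA k hk lam, ∀ g ∈ subgroupA k hk lam, f * g = g * f := by
  rintro _ ⟨a, rfl⟩ _ ⟨b, rfl⟩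
  rw [← map_mul, ← map_mul, mul_comm]

theorem subgroupA0_commute : ∀ f ∈ subgroupA0, ∀ g ∈ subgroupA0, f * g = g * f := by
  rintro _ ⟨a, rfl⟩ _ ⟨b, rfl⟩
  rw [← map_mul, ← map_mul, mul_comm]

/-- The centralizer of `exp X_{k,lam}` is contained in `A_{k,lam}`. -/
theorem mem_subgroupA_of_commute {k : ℕ} (hk : 1 ≤ k) (lam : ℂ) {g : FormalDiff}
    (hg : g * flow (modelField k lam) (X_sq_dvd_modelField hk lam) (Multiplicative.ofAdd 1) =
      flow (modelField k lam) (X_sq_dvd_modelField hk lam) (Multiplicative.ofAdd 1) * g) :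
    g ∈ subgroupA k hk lam := by
  set E := flow (modelField k lam) (X_sq_dvd_modelField hk lam) with hE
  have hd : ∀ t, X ^ (k + 1) ∣ (E t).toSeries - X := fun t =>
    X_pow_dvd_lieSeries_modelField_sub_X hk lam t.toAdd
  have hc : ∀ t, coeff (k + 1) ((E t).toSeries - X) = t.toAdd := fun t => by
    rw [hE, flow_toSeries, coeff_lieSeries_modelField_sub_X hk lam _ le_rfl, if_pos rfl]
  have hmE : ∀ t, multiplier (E t) = 1 := fun t =>
    Units.ext (coeff_one_lieSeries_X (X_sq_dvd_modelField hk lam) _)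
  have hF1 : coeff (k + 1) ((E (Multiplicative.ofAdd 1)).toSeries - X) ≠ 0 := by
    rw [hc]; exact one_ne_zero
  have hξ : multiplier g ^ k = 1 := Units.ext <| by
    rw [Units.val_pow_eq_pow_val, coe_multiplier, Units.val_one]
    exact coeff_one_pow_eq_one_of_commute hg.symm hk (hd _) hF1
  have hcomm : ∀ t ξ, ξ ^ k = 1 → Commute (E t) (homothety ξ) :=
    commute_flow_homothety hk lam
  have hEE : ∀ s t, Commute (E s) (E t) := fun s t => by
    rw [commute_iff_eq, ← map_mul, ← map_mul, mul_comm]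
  set F := E (Multiplicative.ofAdd 1) with hF
  -- A nontrivial map tangent to the identity and commuting with `F` has contact of order exactly
  -- `k`; higher contact forces it to be the identity.
  have key : ∀ f : FormalDiff, multiplier f = 1 → Commute f F → f ≠ 1 →
      X ^ (k + 1) ∣ f.toSeries - X ∧ coeff (k + 1) (f.toSeries - X) ≠ 0 := by
    intro f hf hfF hne
    obtain ⟨l, hl, h1, h2⟩ := exists_leading_term (congrArg Units.val hf) hne
    obtain rfl := eq_of_commute_of_tangent hfF hl hk h1 (hd _) h2 hF1
    exact ⟨h1, h2⟩
  set g₁ := g * (homothety (multiplier g))⁻¹ with hg₁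
  have hg₁m : multiplier g₁ = 1 := by
    rw [hg₁, map_mul, map_inv, multiplier_homothety, mul_inv_cancel]
  have hg₁F : Commute g₁ F := Commute.mul_left hg (hcomm _ _ hξ).symm.inv_left
  obtain ⟨t, ht⟩ : ∃ t, g₁ = E t := by
    by_cases h1 : g₁ = 1
    · exact ⟨1, by rw [h1, map_one]⟩
    obtain ⟨hd₁, hc₁⟩ := key g₁ hg₁m hg₁F h1
    -- Composing `g₁` with the flow at time `-b` cancels its term of degree `k + 1`, so by `key` the
    -- result is the identity.
    set b := coeff (k + 1) (g₁.toSeries - X) with hb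
    refine ⟨Multiplicative.ofAdd b, ?_⟩
    by_contra hne
    have hne' : g₁ * E (Multiplicative.ofAdd (-b)) ≠ 1 := fun h => hne <| by
      rw [ofAdd_neg, map_inv] at h
      exact mul_inv_eq_one.1 h
    refine (key _ (by rw [map_mul, hg₁m, hmE, one_mul]) (hg₁F.mul_left (hEE _ _)) hne').2 ?_
    set s := Multiplicative.ofAdd (-b) with hs
    have e : (g₁ * E s).toSeries - X =
        (g₁.toSeries - X).subst (E s).toSeries + ((E s).toSeries - X) := by
      rw [mul_toSeries, subst_sub (E s).hasSubst, subst_X (E s).hasSubst]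
      ring
    rw [e, map_add, hc, coeff_subst_of_X_pow_dvd (E s).constantCoeff_eq hd₁, ← coe_multiplier,
      hmE, Units.val_one, one_pow, mul_one, ← hb, hs, toAdd_ofAdd, add_neg_cancel]
  rw [mem_subgroupA_iff]
  exact ⟨t, multiplier g, hξ, by rw [← hE, ← ht, hg₁, inv_mul_cancel_right]⟩

/-- The centralizer of `x ↦ 2x` is contained in `A₀`. -/
theorem mem_subgroupA0_of_commute {g : FormalDiff}
    (hg : g * homothety (Units.mk0 2 two_ne_zero) = homothety (Units.mk0 2 two_ne_zero) * g) :
    g ∈ subgroupA0 := by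
  -- The relation is `g(2x) = 2 g(x)`, that is `(2^n - 2) gₙ = 0`, so only `n = 1` survives.
  have h := (mul_eq_homothety_mul_iff g (homothety (Units.mk0 2 two_ne_zero))).1
    (by rwa [multiplier_homothety])
  rw [← coe_multiplier, multiplier_homothety, homothety_toSeries, Units.val_mk0,
    ← rescale_eq_subst] at h
  refine ⟨multiplier g, FormalDiff.ext (PowerSeries.ext fun n => ?_)⟩
  rw [homothety_toSeries, coe_multiplier, coeff_smul, coeff_X]
  rcases n with _ | _ | n
  · simp [g.constantCoeff_eq]
  · simp
  · have hn := congrArg (coeff (n + 2)) h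
    rw [coeff_rescale, coeff_smul, smul_eq_mul, ← sub_eq_zero, ← sub_mul] at hn
    have h2 : (2 : ℂ) ^ (n + 2) - 2 ≠ 0 := by
      rw [sub_ne_zero]
      intro h3
      have h4 : 2 ^ (n + 2) = 2 := by exact_mod_cast h3
      have := Nat.one_le_two_pow (n := n)
      rw [pow_add] at h4
      omega
    rw [(mul_eq_zero.1 hn).resolve_left h2]
    simp

end FormalDiff

/-! ### Maximal abelian subgroups -/

namespace Subgroup

variable {G : Type*} [Group G]

theorem commute_map_conj {A : Subgroup G} (hA : ∀ f ∈ A, ∀ g ∈ A, f * g = g * f) (φ : G) :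
    ∀ f ∈ A.map (MulAut.conj φ).toMonoidHom, ∀ g ∈ A.map (MulAut.conj φ).toMonoidHom,
      f * g = g * f := by
  rintro _ ⟨a, ha, rfl⟩ _ ⟨b, hb, rfl⟩
  rw [← map_mul, ← map_mul, hA a ha b hb]

theorem le_map_conj_of_centralizer {A K : Subgroup G} (hK : ∀ f ∈ K, ∀ g ∈ K, f * g = g * f)
    {z φ : G} (hz : ∀ g, g * z = z * g → g ∈ A) (hzK : MulAut.conj φ z ∈ K) :
    K ≤ A.map (MulAut.conj φ).toMonoidHom := by
  intro g hg
  refine ⟨(MulAut.conj φ).symm g, hz _ ?_, (MulAut.conj φ).apply_symm_apply g⟩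
  apply (MulAut.conj φ).injective
  rw [map_mul, map_mul, MulEquiv.apply_symm_apply]
  exact hK g hg _ hzK

/-- A single `z ∈ A` with centralizer inside `A` certifies maximality: any abelian overgroup of the
conjugate commutes with the conjugate of `z`. -/
theorem maximal_commute_map_conj {A : Subgroup G} (hA : ∀ f ∈ A, ∀ g ∈ A, f * g = g * f)
    {z : G} (hzA : z ∈ A) (hz : ∀ g, g * z = z * g → g ∈ A) (φ : G) :
    Maximal (fun K : Subgroup G => ∀ f ∈ K, ∀ g ∈ K, f * g = g * f)
      (A.map (MulAut.conj φ).toMonoidHom) :=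
  ⟨commute_map_conj hA φ, fun _ hK hle =>
    le_map_conj_of_centralizer hK hz (hle ⟨z, hzA, rfl⟩)⟩

end Subgroup

theorem mainTheorem8 (H : Subgroup FormalDiff) :
    Maximal (fun K : Subgroup FormalDiff => ∀ f ∈ K, ∀ g ∈ K, f * g = g * f) H ↔
      (∃ φ : FormalDiff,
        H = FormalDiff.subgroupA0.map (MulAut.conj φ).toMonoidHom) ∨
      (∃ (k : ℕ) (hk : 1 ≤ k) (lam : ℂ) (φ : FormalDiff),
        H = (FormalDiff.subgroupA k hk lam).map (MulAut.conj φ).toMonoidHom) := by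
  constructor
  · intro hmax
    by_cases hinj : ∀ h ∈ H, FormalDiff.multiplier h = 1 → h = 1
    · left
      obtain ⟨φ, hφ⟩ := FormalDiff.exists_linearization hmax.prop hinj
      refine ⟨φ⁻¹, hmax.eq_of_le (Subgroup.commute_map_conj FormalDiff.subgroupA0_commute _) ?_⟩
      intro h hh
      refine ⟨FormalDiff.homothety (FormalDiff.multiplier h), ⟨_, rfl⟩, ?_⟩
      change φ⁻¹ * FormalDiff.homothety (FormalDiff.multiplier h) * φ⁻¹⁻¹ = h
      rw [inv_inv, mul_assoc, ← hφ h hh, inv_mul_cancel_left]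
    · right
      push Not at hinj
      obtain ⟨f, hfH, hf1, hf⟩ := hinj
      obtain ⟨k, hk, hd, hc⟩ := FormalDiff.exists_leading_term (congrArg Units.val hf1) hf
      obtain ⟨lam, φ, hφ⟩ := FormalDiff.exists_conjugacy_modelField hk hd hc
      refine ⟨k, hk, lam, φ⁻¹,
        hmax.eq_of_le (Subgroup.commute_map_conj (FormalDiff.subgroupA_commute hk lam) _)
        (Subgroup.le_map_conj_of_centralizer hmax.prop
          (fun g => FormalDiff.mem_subgroupA_of_commute hk lam) ?_)⟩
      rw [MulAut.conj_apply, inv_inv, mul_assoc, ← hφ, inv_mul_cancel_left]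
      exact hfH
  · rintro (⟨φ, rfl⟩ | ⟨k, hk, lam, φ, rfl⟩)
    -- The element left implicit is `x ↦ 2x`, fixed by the centralizer statement that follows.
    · exact Subgroup.maximal_commute_map_conj FormalDiff.subgroupA0_commute ⟨_, rfl⟩
        (fun g => FormalDiff.mem_subgroupA0_of_commute) φ
    · exact Subgroup.maximal_commute_map_conj (FormalDiff.subgroupA_commute hk lam)
        ((FormalDiff.mem_subgroupA_iff hk lam _).2
          ⟨Multiplicative.ofAdd 1, 1, one_pow k, by rw [map_one FormalDiff.homothety, mul_one]⟩)
        (fun g => FormalDiff.mem_subgroupA_of_commute hk lam) φ
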